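/- Let $\mathcal C=\{0,1\}^{\mathbb N}$ be the Cantor space with $\nu$ the product of the uniform measures on $\{0,1\}$, let $c>0$, and let $\mathcal M^+_c$ be the set of symmetric Borel measures $\mu$ on $\mathcal C\times\mathcal C$ with $\mu(\mathcal C\times\mathcal C)\le c$. For $k\ge 1$ and $\alpha\in[0,1]^k$ with $\sum_i\alpha_i=1$, let $\mathfrak F_\alpha$ be the set of families $f=(f_1,\dots,f_k)$ of nonnegative measurable functions on $\mathcal C$ with $\sum_i f_i\equiv 1$ and $\int f_i\,d\nu=\alpha_i$; let $M(\mu,f)$ be the $k\times k$ matrix with entries $\int f_i(x)f_j(y)\,d\mu(x,y)$, and let $C(\mu,k)$ be the closure of $\{M(\mu,f): f\in\mathfrak F_{(1/k,\dots,1/k)}\}$. Equip $\mathcal M^+_c$ with the pseudometric $$d_S(\mu_1,\mu_2)=\sum_{k=1}^\infty 2^{-k}D_k\bigl(C(\mu_1,k),C(\mu_2,k)\bigr),$$ where $D_k$ is the Hausdorff distance induced by the $\ell_1$ norm on $\mathbb R^{k\times k}$. For $p>1$, $\eta>0$ and $C\ge 0$ let $R_{C,p,\eta}\subset\mathcal M^+_c$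 be the set of shape $(C,\eta)$-upper $L^p$ regular measures, i.e. of those $\mu$ with $$\|M(\mu,f)\|_{\alpha,p}:=\Bigl(\sum_{i,j}\Bigl|\frac{M(\mu,f)_{ij}}{\alpha_i\alpha_j}\Bigr|^p\alpha_i\alpha_j\Bigr)^{1/p}\le C$$ for all $k\ge1$, all $\alpha\in[\eta,1]^k$ with $\sum_i\alpha_i=1$ and all $f\in\mathfrak F_\alpha$. Let $V_{C,p}\subset\mathcal M^+_c$ be the set of those $\mu\in\mathcal M^+_c$ of the form $\mu=h\cdot(\nu\times\nu)$ with $h\ge0$ and $\|h\|_{L^p(\nu\times\nu)}\le C$. Let $c>0$, $C\ge0$, $p>1$ and $0<\eta\le1$. Then: 1. $R_{C,p,\eta}$ is compact in $(\mathcal M^+_c,d_S)$. 2. In $(\mathcal M^+_c,d_S)$ the union $\bigcup_{0<\varepsilon<C}R_{C-\varepsilon,p,\eta}$ is contained in the interior of $R_{C,p,\eta}$, and every point $\mu$ of the interior with $\mu(\mathcal C\times\mathcal C)<c$ belongs to the union. In particular, if $C<c$, then the interior of $R_{C,p,\eta}$ equals $\bigcup_{0<\varepsilon<C}R_{C-\varepsilon,p,\eta}$.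 3. $V_{C,p}=\bigcap_{\eta'>0}R_{C+\eta',p,\eta'}$. -/

import Mathlib

open MeasureTheory ProbabilityTheory Set

noncomputable section

namespace ShapeLimits

/-- The Cantor space `{0,1}^ℕ`, with its product topology and Borel σ-algebra. -/
abbrev Cantor : Type := ℕ → Bool

/-- The product `ν` of the uniform measures on `{0,1}`. -/
def cantorMeasure : Measure Cantor :=
  Measure.infinitePi (fun _ : ℕ => uniformOn (Set.univ : Set Bool))

/-- `𝓜⁺_c`: symmetric Borel measures on `Cantor × Cantor` of total mass at most `c`. -/
def SymMeasure (c : ℝ) : Type :=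
  {μ : Measure (Cantor × Cantor) //
    μ.map Prod.swap = μ ∧ μ Set.univ ≤ ENNReal.ofReal c}

/-- The set of fractional partitions `𝔉_α`: measurable nonnegative functions `f_1, …, f_k`
with pointwise sum `1` (hence bounded) and integrals `α_1, …, α_k`. -/
def fracPartitions {k : ℕ} (α : Fin k → ℝ) : Set (Fin k → Cantor → ℝ) :=
  {f | (∀ i, Measurable (f i)) ∧ (∀ i x, 0 ≤ f i x) ∧ (∀ x, ∑ i, f i x = 1) ∧
    ∀ i, ∫ x, f i x ∂cantorMeasure = α i}

/-- The matrix `M(μ, f)` with entries `∫ f_i ⊗ f_j dμ`. -/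
def quotientMatrix (μ : Measure (Cantor × Cantor)) {k : ℕ} (f : Fin k → Cantor → ℝ) :
    Matrix (Fin k) (Fin k) ℝ :=
  Matrix.of fun i j => ∫ z, f i z.1 * f j z.2 ∂μ

/-- The `k`-shape `C(μ, k)`: the closure of the set of matrices `M(μ, f)`, where `f` runs over
the fractional partitions into `k` functions of integral `1 / k`. -/
def shape (μ : Measure (Cantor × Cantor)) (k : ℕ) : Set (Matrix (Fin k) (Fin k) ℝ) :=
  closure (quotientMatrix μ '' fracPartitions (fun _ : Fin k => 1 / (k : ℝ)))

/-- A `k × k` matrix as a point of `ℝ^(k × k)` with the `ℓ₁` norm. -/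
def toEllOne {k : ℕ} (M : Matrix (Fin k) (Fin k) ℝ) : PiLp 1 (fun _ : Fin k × Fin k => ℝ) :=
  WithLp.toLp 1 fun q => M q.1 q.2

/-- `D_k`: the Hausdorff distance of sets of `k × k` matrices induced by the `ℓ₁` norm. -/
def matrixHausdorffDist {k : ℕ} (A B : Set (Matrix (Fin k) (Fin k) ℝ)) : ℝ :=
  Metric.hausdorffDist (toEllOne '' A) (toEllOne '' B)

/-- The shape metric `d_S(μ₁, μ₂) = ∑_{k ≥ 1} 2^{-k} D_k(C(μ₁, k), C(μ₂, k))`. -/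
def shapeDist {c : ℝ} (μ₁ μ₂ : SymMeasure c) : ℝ :=
  ∑' k : ℕ, (1 / 2 : ℝ) ^ (k + 1) *
    matrixHausdorffDist (shape μ₁.1 (k + 1)) (shape μ₂.1 (k + 1))

/-! The facts needed to see that `shapeDist` is a pseudometric. -/

instance : IsProbabilityMeasure cantorMeasure := by
  have : IsProbabilityMeasure (uniformOn (Set.univ : Set Bool)) :=
    isProbabilityMeasure_uniformOn Set.finite_univ Set.univ_nonempty
  unfold cantorMeasure
  infer_instance

lemma toEllOne_continuous (k : ℕ) :
    Continuous (toEllOne : Matrix (Fin k) (Fin k) ℝ → _) := by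
  unfold toEllOne
  refine (PiLp.continuous_toLp 1 _).comp ?_
  exact continuous_pi fun q => (continuous_apply q.2).comp (continuous_apply q.1)

lemma shape_nonempty (μ : Measure (Cantor × Cantor)) (k : ℕ) : (shape μ (k + 1)).Nonempty := by
  refine Set.Nonempty.closure (Set.Nonempty.image _ ?_)
  refine ⟨fun _ _ => 1 / ((k + 1 : ℕ) : ℝ), fun i => measurable_const, fun i x => by positivity,
    fun x => ?_, fun i => by simp⟩
  have : ((k : ℝ) + 1) ≠ 0 := by positivity
  simp [this]

lemma quotientMatrix_mem {c : ℝ} (μ : SymMeasure c) {k : ℕ} {α : Fin k → ℝ}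
    {f : Fin k → Cantor → ℝ} (hf : f ∈ fracPartitions α) :
    (∀ i j, 0 ≤ quotientMatrix μ.1 f i j) ∧
      ∑ i, ∑ j, quotientMatrix μ.1 f i j ≤ max c 0 := by
  obtain ⟨hm, h0, h1, -⟩ := hf
  have : IsFiniteMeasure μ.1 := ⟨lt_of_le_of_lt μ.2.2 ENNReal.ofReal_lt_top⟩
  have hle : ∀ i x, f i x ≤ 1 := fun i x => by
    rw [← h1 x]
    exact Finset.single_le_sum (f := fun i => f i x) (fun j _ => h0 j x) (Finset.mem_univ i)
  have hint : ∀ i j, Integrable (fun z : Cantor × Cantor => f i z.1 * f j z.2) μ.1 := by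
    intro i j
    refine Integrable.of_bound (C := 1)
      (((hm i).comp measurable_fst).mul ((hm j).comp measurable_snd)).aestronglyMeasurable ?_
    refine Filter.Eventually.of_forall fun z => ?_
    rw [Real.norm_of_nonneg (mul_nonneg (h0 i _) (h0 j _))]
    exact mul_le_one₀ (hle i _) (h0 j _) (hle j _)
  refine ⟨fun i j => integral_nonneg fun z => mul_nonneg (h0 i _) (h0 j _), ?_⟩
  have key : ∑ i, ∑ j, quotientMatrix μ.1 f i j = μ.1.real Set.univ := by
    simp only [quotientMatrix, Matrix.of_apply]
    have h2 : ∀ i, ∑ j, ∫ z, f i z.1 * f j z.2 ∂μ.1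
        = ∫ z, ∑ j, f i z.1 * f j z.2 ∂μ.1 := fun i =>
      (integral_finsetSum _ fun j _ => hint i j).symm
    simp only [h2]
    rw [← integral_finsetSum _ fun i _ => integrable_finsetSum _ fun j _ => hint i j]
    simp [← Finset.mul_sum, h1]
  rw [key]
  have := ENNReal.toReal_mono ENNReal.ofReal_ne_top μ.2.2
  rwa [ENNReal.toReal_ofReal'] at this

lemma shape_subset_closedBall {c : ℝ} (μ : SymMeasure c) (k : ℕ) :
    toEllOne '' shape μ.1 k ⊆ Metric.closedBall 0 (max c 0) := by
  rw [Set.image_subset_iff]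
  refine closure_minimal ?_ (Metric.isClosed_closedBall.preimage (toEllOne_continuous k))
  rintro _ ⟨f, hf, rfl⟩
  obtain ⟨h0, hs⟩ := quotientMatrix_mem μ hf
  rw [Set.mem_preimage, mem_closedBall_zero_iff, PiLp.norm_eq_of_L1]
  refine le_trans (le_of_eq ?_) hs
  rw [Fintype.sum_prod_type]
  refine Finset.sum_congr rfl fun i _ => Finset.sum_congr rfl fun j _ => ?_
  simp [toEllOne, abs_of_nonneg (h0 i j)]

lemma shape_hausdorffEDist_ne_top {c : ℝ} (μ₁ μ₂ : SymMeasure c) (k : ℕ) :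
    Metric.hausdorffEDist (toEllOne '' shape μ₁.1 (k + 1)) (toEllOne '' shape μ₂.1 (k + 1)) ≠ ⊤ :=
  Metric.hausdorffEDist_ne_top_of_nonempty_of_bounded ((shape_nonempty _ k).image _)
    ((shape_nonempty _ k).image _)
    (Metric.isBounded_closedBall.subset (shape_subset_closedBall μ₁ _))
    (Metric.isBounded_closedBall.subset (shape_subset_closedBall μ₂ _))

lemma matrixHausdorffDist_shape_le {c : ℝ} (μ₁ μ₂ : SymMeasure c) (k : ℕ) :
    matrixHausdorffDist (shape μ₁.1 (k + 1)) (shape μ₂.1 (k + 1)) ≤ 2 * max c 0 := by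
  have hd : ∀ x ∈ Metric.closedBall (0 : PiLp 1 (fun _ : Fin (k + 1) × Fin (k + 1) => ℝ))
      (max c 0), ∀ y ∈ Metric.closedBall (0 : PiLp 1 (fun _ : Fin (k + 1) × Fin (k + 1) => ℝ))
      (max c 0), dist x y ≤ 2 * max c 0 := fun x hx y hy => by
    have := dist_triangle_right x y 0
    rw [Metric.mem_closedBall] at hx hy
    linarith
  have h1 := (shape_nonempty μ₁.1 k).image toEllOne
  have h2 := (shape_nonempty μ₂.1 k).image toEllOne
  refine Metric.hausdorffDist_le_of_mem_dist (by positivity) (fun x hx => ?_) (fun x hx => ?_)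
  · obtain ⟨y, hy⟩ := h2
    exact ⟨y, hy, hd _ (shape_subset_closedBall μ₁ _ hx) _ (shape_subset_closedBall μ₂ _ hy)⟩
  · obtain ⟨y, hy⟩ := h1
    exact ⟨y, hy, hd _ (shape_subset_closedBall μ₂ _ hx) _ (shape_subset_closedBall μ₁ _ hy)⟩

lemma shapeDist_summable {c : ℝ} (μ₁ μ₂ : SymMeasure c) :
    Summable fun k : ℕ => (1 / 2 : ℝ) ^ (k + 1) *
      matrixHausdorffDist (shape μ₁.1 (k + 1)) (shape μ₂.1 (k + 1)) := by
  have hg : Summable fun k : ℕ => (1 / 2 : ℝ) ^ (k + 1) * (2 * max c 0) :=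
    ((summable_nat_add_iff 1).2 summable_geometric_two).mul_right _
  refine Summable.of_nonneg_of_le (fun k => ?_) (fun k => ?_) hg
  · exact mul_nonneg (by positivity) Metric.hausdorffDist_nonneg
  · exact mul_le_mul_of_nonneg_left (matrixHausdorffDist_shape_le μ₁ μ₂ k) (by positivity)

/-- `𝓜⁺_c` with the shape metric. -/
instance (c : ℝ) : PseudoMetricSpace (SymMeasure c) where
  dist := shapeDist
  dist_self μ := by simp [shapeDist, matrixHausdorffDist]
  dist_comm μ₁ μ₂ := by
    simp only [shapeDist, matrixHausdorffDist, Metric.hausdorffDist_comm]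
  dist_triangle μ₁ μ₂ μ₃ := by
    unfold shapeDist
    rw [← (shapeDist_summable μ₁ μ₂).tsum_add (shapeDist_summable μ₂ μ₃)]
    refine (shapeDist_summable μ₁ μ₃).tsum_le_tsum (fun k => ?_)
      ((shapeDist_summable μ₁ μ₂).add (shapeDist_summable μ₂ μ₃))
    rw [← mul_add]
    exact mul_le_mul_of_nonneg_left
      (Metric.hausdorffDist_triangle (shape_hausdorffEDist_ne_top μ₁ μ₂ k)) (by positivity)

/-- The weighted norm `‖M‖_{α,p} = (∑_{i,j} |M_{ij} / (α_i α_j)|^p α_i α_j)^{1/p}`. -/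
def weightedNorm {k : ℕ} (α : Fin k → ℝ) (p : ℝ) (M : Matrix (Fin k) (Fin k) ℝ) : ℝ :=
  (∑ i, ∑ j, |M i j / (α i * α j)| ^ p * (α i * α j)) ^ (1 / p)

/-- `R_{C,p,η} ⊆ 𝓜⁺_c`: the shape `(C, η)`-upper `L^p` regular measures. -/
def shapeRegular (c C p η : ℝ) : Set (SymMeasure c) :=
  {μ | ∀ k : ℕ, 0 < k → ∀ α : Fin k → ℝ, (∀ i, α i ∈ Set.Icc η 1) → ∑ i, α i = 1 →
    ∀ f ∈ fracPartitions α, weightedNorm α p (quotientMatrix μ.1 f) ≤ C}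

/-- `V_{C,p} ⊆ 𝓜⁺_c`: the measures `h · (ν × ν)` with `h ≥ 0` and `‖h‖_p ≤ C`. -/
def lpBall (c C p : ℝ) : Set (SymMeasure c) :=
  {μ | ∃ h : Cantor × Cantor → ℝ, (∀ z, 0 ≤ h z) ∧
    MemLp h (ENNReal.ofReal p) (cantorMeasure.prod cantorMeasure) ∧
    eLpNorm h (ENNReal.ofReal p) (cantorMeasure.prod cantorMeasure) ≤ ENNReal.ofReal C ∧
    μ.1 = (cantorMeasure.prod cantorMeasure).withDensity fun z => ENNReal.ofReal (h z)}

end ShapeLimits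

end

/-!
The measure space `(Cantor, ν)` enters the problem only through quotient matrices `M(μ, f)`, and
the proof works with these matrices over arbitrary standard Borel spaces.

*Compactness of `𝓜⁺_c`* (`isCompact_univ_symMeasure`). Given an ultrafilter of measures, choose for
each measure countably many fractional partitions whose matrices exhaust all its shapes. They map
the Cantor space to a compact metrizable space `K`, a product of simplices, and the images of `ν`
and of the measures have weak limits `ρ` on `K` and `μ'` on `K × K`. The coordinates of `K` realize
limits of the chosen matrices; conversely, every fractional partition of `K` is `L¹`-close to a
continuous one, which pulls back to the Cantor space. So the shapes converge to those of
`(K, ρ, μ')`. Finally `(K, ρ, μ')` has the same quotient matrices as some measure over the Cantor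
space (`exists_symMeasure_of_standardBorel`). As `μ'` may charge sets over `ρ`-null sets, this needs
an embedding of a standard atomless probability space into `(Cantor, ν)` that is injective
everywhere (`exists_embedding_cantorMeasure`): an almost everywhere isomorphism, through the
uniform law on `[0, 1]`, is modified on a null set by an embedding into a null set.

*Regularity and the metric* (`exists_pos_forall_exists_close`). The shapes only see partitions into
functions of equal integral. For `α` bounded below by `η`, round `α` to multiples of `1 / N`, split
the functions into parts of integral `1 / N`, use closeness of the `N`-shapes, and merge. Hence
nearby measures have nearby matrices for all such `α`, uniformly, and
`R_{C,p,η}` is closed, hence compact, and contained in the interior of `R_{C',p,η}` for `C < C'`.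
An interior point `μ` of mass less than `c` stays in `R_{C,p,η}` when multiplied by `1 + t` for a
small `t > 0`, so that `μ ∈ R_{C/(1+t),p,η}`.

*Densities* (`lpBall_eq_iInter`). If `μ` has a density `h` with `‖h‖_p ≤ C`, then Hölder's
inequality bounds all weighted norms by `C`. Conversely, a measure that is regular at all scales
satisfies `∫ g dμ ≤ C ‖g‖_q`, first for functions of initial segments by the finite Hölder
inequality, then for bounded measurable functions by martingale convergence with respect to
`μ + ν × ν` (`IsUpperRegular.integral_le`). Indicators show that `μ` is absolutely continuous, and
`g = min(h, K) ^ (p - 1)` shows `‖h‖_p ≤ C`.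
-/

namespace ShapeLimits

open Filter Topology

/-! ### Fractional partitions over an arbitrary space -/

section Framework

variable {X : Type*} [MeasurableSpace X]

/-- A fractional partition: finitely many nonnegative measurable functions with pointwise sum
`1`, without any condition on their integrals. -/
structure IsFracPartition {k : ℕ} (f : Fin k → X → ℝ) : Prop where
  measurable : ∀ i, Measurable (f i)
  nonneg : ∀ i x, 0 ≤ f i x
  sum_eq : ∀ x, ∑ i, f i x = 1

/-- The set `𝔉_α` over a measure space `(X, ρ)` in place of `(Cantor, ν)`. -/
def fracPartitionsOn (ρ : Measure X) {k : ℕ} (α : Fin k → ℝ) : Set (Fin k → X → ℝ) :=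
  {f | IsFracPartition f ∧ ∀ i, ∫ x, f i x ∂ρ = α i}

/-- The matrix `M(μ, f)` for a measure `μ` on `X × X`. -/
noncomputable def quotientMatrixOn (μ : Measure (X × X)) {k : ℕ} (f : Fin k → X → ℝ) :
    Matrix (Fin k) (Fin k) ℝ :=
  Matrix.of fun i j => ∫ z, f i z.1 * f j z.2 ∂μ

lemma mem_fracPartitions_iff {k : ℕ} {α : Fin k → ℝ} {f : Fin k → Cantor → ℝ} :
    f ∈ fracPartitions α ↔ f ∈ fracPartitionsOn cantorMeasure α :=
  ⟨fun h => ⟨⟨h.1, h.2.1, h.2.2.1⟩, h.2.2.2⟩, fun h => ⟨h.1.1, h.1.2, h.1.3, h.2⟩⟩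

lemma fracPartitions_eq {k : ℕ} (α : Fin k → ℝ) :
    fracPartitions α = fracPartitionsOn cantorMeasure α :=
  Set.ext fun _ => mem_fracPartitions_iff

lemma quotientMatrix_eq (μ : Measure (Cantor × Cantor)) {k : ℕ} (f : Fin k → Cantor → ℝ) :
    quotientMatrix μ f = quotientMatrixOn μ f := rfl

namespace IsFracPartition

variable {k : ℕ} {f g : Fin k → X → ℝ}

lemma le_one (hf : IsFracPartition f) (i : Fin k) (x : X) : f i x ≤ 1 := by
  rw [← hf.sum_eq x]
  exact Finset.single_le_sum (f := fun i => f i x) (fun j _ => hf.nonneg j x) (Finset.mem_univ i)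

lemma abs_le_one (hf : IsFracPartition f) (i : Fin k) (x : X) : |f i x| ≤ 1 := by
  rw [abs_of_nonneg (hf.nonneg i x)]; exact hf.le_one i x

lemma integrable (hf : IsFracPartition f) (ρ : Measure X) [IsFiniteMeasure ρ] (i : Fin k) :
    Integrable (f i) ρ :=
  Integrable.of_bound (C := 1) (hf.measurable i).aestronglyMeasurable
    (Eventually.of_forall fun x => hf.abs_le_one i x)

lemma measurable_mul (hf : IsFracPartition f) (i j : Fin k) :
    Measurable fun z : X × X => f i z.1 * f j z.2 :=
  ((hf.measurable i).comp measurable_fst).mul ((hf.measurable j).comp measurable_snd)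

lemma entry_nonneg (hf : IsFracPartition f) (i j : Fin k) (z : X × X) :
    0 ≤ f i z.1 * f j z.2 := mul_nonneg (hf.nonneg i _) (hf.nonneg j _)

lemma entry_le_one (hf : IsFracPartition f) (i j : Fin k) (z : X × X) :
    f i z.1 * f j z.2 ≤ 1 := mul_le_one₀ (hf.le_one i _) (hf.nonneg j _) (hf.le_one j _)

lemma integrable_mul (hf : IsFracPartition f) (μ : Measure (X × X)) [IsFiniteMeasure μ]
    (i j : Fin k) : Integrable (fun z : X × X => f i z.1 * f j z.2) μ :=
  Integrable.of_bound (C := 1) (hf.measurable_mul i j).aestronglyMeasurable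
    (Eventually.of_forall fun z => by
      rw [Real.norm_of_nonneg (hf.entry_nonneg i j z)]; exact hf.entry_le_one i j z)

lemma quotientMatrixOn_nonneg (hf : IsFracPartition f) (μ : Measure (X × X)) (i j : Fin k) :
    0 ≤ quotientMatrixOn μ f i j :=
  integral_nonneg fun z => hf.entry_nonneg i j z

/-- The sum of the integrals of a fractional partition is the total mass. -/
lemma sum_integral (hf : IsFracPartition f) (ρ : Measure X) [IsProbabilityMeasure ρ] :
    ∑ i, ∫ x, f i x ∂ρ = 1 := by
  rw [← integral_finsetSum _ fun i _ => hf.integrable ρ i]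
  simp [hf.sum_eq]

lemma sum_quotientMatrixOn (hf : IsFracPartition f) (μ : Measure (X × X)) [IsFiniteMeasure μ] :
    ∑ i, ∑ j, quotientMatrixOn μ f i j = μ.real univ := by
  simp only [quotientMatrixOn, Matrix.of_apply]
  have h2 : ∀ i, ∑ j, ∫ z, f i z.1 * f j z.2 ∂μ = ∫ z, ∑ j, f i z.1 * f j z.2 ∂μ := fun i =>
    (integral_finsetSum _ fun j _ => hf.integrable_mul μ i j).symm
  simp only [h2]
  rw [← integral_finsetSum _ fun i _ => integrable_finsetSum _ fun j _ => hf.integrable_mul μ i j]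
  simp [← Finset.mul_sum, hf.sum_eq]

lemma comp {Y : Type*} [MeasurableSpace Y] (hf : IsFracPartition f) {φ : Y → X}
    (hφ : Measurable φ) : IsFracPartition fun i y => f i (φ y) :=
  ⟨fun i => (hf.measurable i).comp hφ, fun i _ => hf.nonneg i _, fun _ => hf.sum_eq _⟩

/-- The entries of `M(μ, f)` depend on `f` in an `L¹`-continuous way with respect to the
marginals of `μ`. -/
lemma abs_quotientMatrixOn_sub_le (hf : IsFracPartition f) (hg : IsFracPartition g)
    (μ : Measure (X × X)) [IsFiniteMeasure μ] (i j : Fin k) :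
    |quotientMatrixOn μ f i j - quotientMatrixOn μ g i j| ≤
      ∫ x, |f i x - g i x| ∂(μ.map Prod.fst) + ∫ x, |f j x - g j x| ∂(μ.map Prod.snd) := by
  have hm : ∀ i, Measurable fun x => |f i x - g i x| := fun i =>
    ((hf.measurable i).sub (hg.measurable i)).abs
  have hint : ∀ (ρ : Measure X) [IsFiniteMeasure ρ] i, Integrable (fun x => |f i x - g i x|) ρ :=
    fun ρ _ i => ((hf.integrable ρ i).sub (hg.integrable ρ i)).abs
  have h1 : Integrable (fun z : X × X => |f i z.1 - g i z.1|) μ :=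
    (hint (μ.map Prod.fst) i).comp_measurable measurable_fst
  have h2 : Integrable (fun z : X × X => |f j z.2 - g j z.2|) μ :=
    (hint (μ.map Prod.snd) j).comp_measurable measurable_snd
  rw [integral_map measurable_fst.aemeasurable (hm i).aestronglyMeasurable,
    integral_map measurable_snd.aemeasurable (hm j).aestronglyMeasurable, ← integral_add h1 h2]
  simp only [quotientMatrixOn, Matrix.of_apply]
  rw [← integral_sub (hf.integrable_mul μ i j) (hg.integrable_mul μ i j)]
  refine abs_integral_le_integral_abs.trans
    (integral_mono ((hf.integrable_mul μ i j).sub (hg.integrable_mul μ i j)).abs (h1.add h2) ?_)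
  intro z
  have e : f i z.1 * f j z.2 - g i z.1 * g j z.2 =
      (f i z.1 - g i z.1) * f j z.2 + g i z.1 * (f j z.2 - g j z.2) := by ring
  change |f i z.1 * f j z.2 - g i z.1 * g j z.2| ≤ |f i z.1 - g i z.1| + |f j z.2 - g j z.2|
  rw [e]
  refine (abs_add_le _ _).trans (add_le_add ?_ ?_)
  · rw [abs_mul]
    exact mul_le_of_le_one_right (abs_nonneg _) (hf.abs_le_one j _)
  · rw [abs_mul]
    exact mul_le_of_le_one_left (abs_nonneg _) (hg.abs_le_one i _)

lemma abs_quotientMatrixOn_sub_le_of_forall (hf : IsFracPartition f) (hg : IsFracPartition g)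
    (μ : Measure (X × X)) [IsFiniteMeasure μ] {δ : ℝ} (h : ∀ i x, |f i x - g i x| ≤ δ)
    (i j : Fin k) :
    |quotientMatrixOn μ f i j - quotientMatrixOn μ g i j| ≤ 2 * δ * μ.real univ := by
  have key : ∀ (ρ : Measure X) [IsFiniteMeasure ρ] i, ∫ x, |f i x - g i x| ∂ρ ≤ δ * ρ.real univ :=
    fun ρ _ i => by
      have := integral_mono ((hf.integrable ρ i).sub (hg.integrable ρ i)).abs
        (integrable_const δ) (h i)
      simpa [mul_comm] using! this
  have h1 := key (μ.map Prod.fst) i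
  have h2 := key (μ.map Prod.snd) j
  rw [map_measureReal_apply measurable_fst .univ, preimage_univ] at h1
  rw [map_measureReal_apply measurable_snd .univ, preimage_univ] at h2
  linarith [hf.abs_quotientMatrixOn_sub_le hg μ i j]

/-- A fractional partition whose integrals are close to `α` is uniformly close to a member
of `𝔉_α`: shrink it and add suitable constants. -/
lemma exists_mem_fracPartitionsOn (hg : IsFracPartition g) (ρ : Measure X)
    [IsProbabilityMeasure ρ] {α : Fin k → ℝ} (hα : ∑ i, α i = 1) {ε : ℝ} (hε0 : 0 ≤ ε)
    (hε1 : ε ≤ 1) (h : ∀ i, ∫ x, g i x ∂ρ ≤ (1 + ε) * α i) :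
    ∃ f ∈ fracPartitionsOn ρ α, ∀ i x, |f i x - g i x| ≤ ε := by
  set β : Fin k → ℝ := fun i => ∫ x, g i x ∂ρ with hβ
  have hβ1 : ∑ i, β i = 1 := hg.sum_integral ρ
  have hβ0 : ∀ i, 0 ≤ β i := fun i => integral_nonneg (hg.nonneg i)
  -- `(1 - ε) β ≤ (1 - ε) (1 + ε) α ≤ α`, so the constants below are nonnegative
  have hc : ∀ i, 0 ≤ α i - (1 - ε) * β i := fun i => by
    have := mul_le_mul_of_nonneg_left (h i) (sub_nonneg.2 hε1)
    have h' := hβ0 i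
    have hαi : 0 ≤ α i := by
      have := (hβ0 i).trans (h i)
      exact nonneg_of_mul_nonneg_right this (by linarith)
    nlinarith [mul_nonneg (mul_nonneg hε0 hε0) hαi]
  have hs : ∑ i, (α i - (1 - ε) * β i) = ε := by
    rw [Finset.sum_sub_distrib, ← Finset.mul_sum, hα, hβ1]; ring
  have hcε : ∀ i, α i - (1 - ε) * β i ≤ ε := fun i =>
    (Finset.single_le_sum (f := fun i => α i - (1 - ε) * β i) (fun j _ => hc j)
      (Finset.mem_univ i)).trans hs.le
  refine ⟨fun i x => (1 - ε) * g i x + (α i - (1 - ε) * β i), ⟨⟨fun i => ?_, fun i x => ?_,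
    fun x => ?_⟩, fun i => ?_⟩, fun i x => ?_⟩
  · exact ((hg.measurable i).const_mul _).add_const _
  · exact add_nonneg (mul_nonneg (sub_nonneg.2 hε1) (hg.nonneg i x)) (hc i)
  · rw [Finset.sum_add_distrib, ← Finset.mul_sum, hg.sum_eq, hs]; ring
  · rw [integral_add ((hg.integrable ρ i).const_mul _) (integrable_const _), integral_const_mul]
    simp [hβ]
  · have h1 := hc i
    have h2 := hcε i
    have h3 := mul_nonneg hε0 (hg.nonneg i x)
    have h4 := mul_le_mul_of_nonneg_left (hg.le_one i x) hε0
    rw [abs_le]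
    constructor <;> dsimp only <;> linarith

end IsFracPartition

end Framework

/-- A uniform change `δ` of the partition that moves no entry of a quotient matrix of a measure of
mass at most `c` by more than `ε / 3`, see `abs_quotientMatrixOn_sub_le_of_forall`. -/
lemma exists_correction_size {c ε : ℝ} (hc : 0 ≤ c) (hε : 0 < ε) :
    ∃ δ : ℝ, 0 < δ ∧ δ ≤ 1 ∧ 2 * δ * c ≤ ε / 3 := by
  refine ⟨min 1 (ε / (6 * (c + 1))), by positivity, min_le_left _ _, ?_⟩
  have h1 : min 1 (ε / (6 * (c + 1))) * (6 * (c + 1)) ≤ ε := by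
    rw [← le_div_iff₀ (by positivity)]; exact min_le_right _ _
  have h2 : 0 < min 1 (ε / (6 * (c + 1))) := by positivity
  nlinarith

/-! ### Matrices with the `ℓ₁` distance -/

lemma dist_toEllOne {k : ℕ} (A B : Matrix (Fin k) (Fin k) ℝ) :
    dist (toEllOne A) (toEllOne B) = ∑ i, ∑ j, |A i j - B i j| := by
  rw [PiLp.dist_eq_of_L1, Fintype.sum_prod_type]
  rfl

lemma dist_toEllOne_le {k : ℕ} {A B : Matrix (Fin k) (Fin k) ℝ} {ε : ℝ}
    (h : ∀ i j, |A i j - B i j| ≤ ε) : dist (toEllOne A) (toEllOne B) ≤ k ^ 2 * ε := by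
  rw [dist_toEllOne]
  refine (Finset.sum_le_sum fun i _ => Finset.sum_le_sum fun j _ => h i j).trans ?_
  simp [sq, mul_assoc]

instance {c : ℝ} (μ : SymMeasure c) : IsFiniteMeasure μ.1 :=
  ⟨lt_of_le_of_lt μ.2.2 ENNReal.ofReal_lt_top⟩

lemma SymMeasure.real_univ_le {c : ℝ} (hc : 0 ≤ c) (μ : SymMeasure c) : μ.1.real univ ≤ c := by
  have := ENNReal.toReal_mono ENNReal.ofReal_ne_top μ.2.2
  rwa [ENNReal.toReal_ofReal hc] at this

/-! ### Atomless probability measures on standard Borel spaces -/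

/-- The cumulative distribution function of an atomless measure is continuous. -/
lemma continuous_cdf (ρ : Measure ℝ) [IsProbabilityMeasure ρ] [NullSingletonClass ρ] :
    Continuous (cdf ρ) := by
  refine continuous_iff_continuousAt.2 fun x => ?_
  rw [(cdf ρ).mono.continuousAt_iff_leftLim_eq_rightLim, StieltjesFunction.rightLim_eq]
  have h := StieltjesFunction.measure_singleton (cdf ρ) x
  rw [measure_cdf, measure_singleton] at h
  exact le_antisymm ((cdf ρ).mono.leftLim_le le_rfl)
    (sub_nonpos.1 (ENNReal.ofReal_eq_zero.1 h.symm))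

/-- The probability integral transform: the value of the cumulative distribution function of an
atomless measure is uniformly distributed. -/
lemma measure_setOf_cdf_le (ρ : Measure ℝ) [IsProbabilityMeasure ρ] [NullSingletonClass ρ] {t : ℝ}
    (ht0 : 0 < t) (ht1 : t < 1) : ρ {x | cdf ρ x ≤ t} = ENNReal.ofReal t := by
  have hval : ∀ s, 0 < s → s < 1 → ∃ a, cdf ρ a = s := fun s h0 h1 => by
    obtain ⟨a, ha⟩ := ((tendsto_cdf_atBot ρ).eventually_lt_const h0).exists
    obtain ⟨b, hb⟩ := ((tendsto_cdf_atTop ρ).eventually_const_lt h1).exists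
    exact mem_range_of_exists_le_of_exists_ge (continuous_cdf ρ) ⟨a, ha.le⟩ ⟨b, hb.le⟩
  refine le_antisymm ?_ ?_
  · refine le_of_forall_gt_imp_ge_of_dense fun s hs => ?_
    rcases le_or_gt 1 s with h1 | h1
    · exact prob_le_one.trans h1
    lift s to NNReal using h1.ne_top
    have hs' : t < s := by
      rw [ENNReal.ofReal, ENNReal.coe_lt_coe] at hs
      exact (Real.toNNReal_lt_iff_lt_coe ht0.le).1 hs
    obtain ⟨a, ha⟩ := hval s (ht0.trans hs') (by exact_mod_cast h1)
    have hsub : {x | cdf ρ x ≤ t} ⊆ Iic a := fun x hx => by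
      by_contra hxa
      have := monotone_cdf ρ (not_le.1 hxa).le
      have hx' : cdf ρ x ≤ t := hx
      linarith
    refine (measure_mono hsub).trans ?_
    rw [← ofReal_cdf, ha, ENNReal.ofReal_coe_nnreal]
  · obtain ⟨a, ha⟩ := hval t ht0 ht1
    rw [← ha, ofReal_cdf]
    exact measure_mono fun x hx => monotone_cdf ρ hx

/-- An atomless measure is carried to the uniform law on `[0, 1]` by its cumulative distribution
function. -/
lemma map_cdf (ρ : Measure ℝ) [IsProbabilityMeasure ρ] [NullSingletonClass ρ] :
    ρ.map (cdf ρ) = volume.restrict (Icc 0 1) := by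
  have hm : Measurable (cdf ρ) := (continuous_cdf ρ).measurable
  have : IsProbabilityMeasure (ρ.map (cdf ρ)) := Measure.isProbabilityMeasure_map hm.aemeasurable
  have hp : IsProbabilityMeasure (volume.restrict (Icc (0 : ℝ) 1)) := ⟨by simp⟩
  refine Measure.ext_of_Iic _ _ fun t => ?_
  rw [Measure.map_apply hm measurableSet_Iic, Measure.restrict_apply measurableSet_Iic]
  have hI : Iic t ∩ Icc (0 : ℝ) 1 = Icc 0 (min t 1) := by
    ext x; simp only [mem_inter_iff, mem_Iic, mem_Icc, le_min_iff]; tauto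
  rw [hI, Real.volume_Icc, sub_zero]
  rcases le_or_gt 1 t with h1 | h1
  · have : cdf ρ ⁻¹' Iic t = univ := eq_univ_of_forall fun x => (cdf_le_one ρ x).trans h1
    rw [this, min_eq_right h1, measure_univ, ENNReal.ofReal_one]
  rw [min_eq_left h1.le]
  rcases lt_or_ge 0 t with h0 | h0
  · exact measure_setOf_cdf_le ρ h0 h1
  rw [ENNReal.ofReal_of_nonpos h0, ← nonpos_iff_eq_zero]
  have hlim : Tendsto (fun s : ℝ => ENNReal.ofReal s) (𝓝[>] 0) (𝓝 0) := by
    have := (ENNReal.continuous_ofReal.tendsto 0).mono_left (nhdsWithin_le_nhds (s := Ioi 0))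
    rwa [ENNReal.ofReal_zero] at this
  refine ge_of_tendsto hlim ?_
  filter_upwards [Ioo_mem_nhdsGT (zero_lt_one (α := ℝ))] with s hs
  rw [← measure_setOf_cdf_le ρ hs.1 hs.2]
  exact measure_mono fun x (hx : cdf ρ x ≤ t) => hx.trans (h0.trans hs.1.le)

/-- An atomless probability measure on a standard Borel space admits a measurable map `U` to the
real line with the uniform law and with a left inverse almost everywhere. -/
lemma exists_uniform_coordinate {X : Type*} [MeasurableSpace X] [StandardBorelSpace X]
    (ρ : Measure X) [IsProbabilityMeasure ρ] [NullSingletonClass ρ] :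
    ∃ (U : X → ℝ) (V : ℝ → X), Measurable U ∧ Measurable V ∧
      ρ.map U = volume.restrict (Icc 0 1) ∧ ∀ᵐ x ∂ρ, V (U x) = x := by
  have he := measurableEmbedding_embeddingReal X
  set e := embeddingReal X
  set ρ' := ρ.map e with hρ'
  have : IsProbabilityMeasure ρ' := Measure.isProbabilityMeasure_map he.measurable.aemeasurable
  have : NullSingletonClass ρ' := ⟨fun x => by
    rw [hρ', Measure.map_apply he.measurable (measurableSet_singleton x)]
    exact ((subsingleton_singleton).preimage he.injective).measure_zero ρ⟩
  have hF : Measurable (cdf ρ') := (continuous_cdf ρ').measurable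
  have hU : Measurable fun x => cdf ρ' (e x) := hF.comp he.measurable
  have hlaw : ρ.map (fun x => cdf ρ' (e x)) = volume.restrict (Icc 0 1) := by
    rw [← map_cdf ρ', hρ', Measure.map_map hF he.measurable]; rfl
  -- the distribution function is injective off the preimage of its values at rationals
  set D : Set ℝ := range fun q : ℚ => cdf ρ' q
  have hD : D.Countable := countable_range _
  set S : Set X := {x | cdf ρ' (e x) ∉ D}
  have hS : MeasurableSet S := (hU hD.measurableSet).compl
  have hS0 : ∀ᵐ x ∂ρ, x ∈ S := by
    have h0 : (ρ.map fun x => cdf ρ' (e x)) D = 0 := by rw [hlaw]; exact hD.measure_zero _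
    rw [Measure.map_apply hU hD.measurableSet] at h0
    exact measure_eq_zero_iff_ae_notMem.1 h0
  have hlt : ∀ x ∈ S, ∀ y ∈ S, e x < e y → cdf ρ' (e x) ≠ cdf ρ' (e y) := fun x hx y _ hxy h => by
    obtain ⟨q, hq1, hq2⟩ := exists_rat_btwn hxy
    refine hx ⟨q, le_antisymm ?_ (monotone_cdf ρ' hq1.le)⟩
    exact (monotone_cdf ρ' hq2.le).trans h.ge
  have hinj : InjOn (fun x => cdf ρ' (e x)) S := fun x hx y hy h => by
    rcases lt_trichotomy (e x) (e y) with hxy | hxy | hxy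
    · exact absurd h (hlt x hx y hy hxy)
    · exact he.injective hxy
    · exact absurd h.symm (hlt y hy x hx hxy)
  have : StandardBorelSpace S := hS.standardBorel
  have hemb : MeasurableEmbedding (S.domRestrict fun x => cdf ρ' (e x)) :=
    (hU.comp measurable_subtype_coe).measurableEmbedding (injOn_iff_injective.1 hinj)
  have : Nonempty X := nonempty_of_isProbabilityMeasure ρ
  obtain ⟨V, hV, hVe⟩ := hemb.exists_measurable_extend measurable_subtype_coe
    (fun _ => ‹Nonempty X›)
  refine ⟨_, V, hU, hV, hlaw, hS0.mono fun x hx => ?_⟩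
  exact congrFun hVe ⟨x, hx⟩

/-- The set of sequences whose even entries vanish: an uncountable null set. -/
def evenZero : Set Cantor := {z | ∀ n, z (2 * n) = false}

lemma measurableSet_evenZero : MeasurableSet evenZero := by
  have : evenZero = ⋂ n, {z : Cantor | z (2 * n) = false} := by ext; simp [evenZero]
  rw [this]
  refine MeasurableSet.iInter fun n => ?_
  exact (measurable_pi_apply (X := fun _ : ℕ => Bool) (2 * n)) (measurableSet_singleton false)

/-- Cylinder sets with prescribed values on `s` have measure `2 ^ (-|s|)`. -/
lemma cantorMeasure_cylinder (s : Finset ℕ) (w : Cantor) :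
    cantorMeasure {z | ∀ n ∈ s, z n = w n} = 2⁻¹ ^ s.card := by
  have : {z : Cantor | ∀ n ∈ s, z n = w n} = Set.pi s fun n => {w n} := by
    ext; simp [Set.mem_pi]
  rw [this, cantorMeasure, Measure.infinitePi_pi _ fun i _ => measurableSet_singleton _]
  have h : ∀ b : Bool, uniformOn (Set.univ : Set Bool) {b} = 2⁻¹ := fun b => by
    rw [uniformOn_univ]; simp
  simp only [h, Finset.prod_const]

lemma cantorMeasure_eq_zero_of_forall (s : Set Cantor) (w : Cantor) {ι : ℕ → ℕ}
    (hι : Function.Injective ι) (h : ∀ z ∈ s, ∀ n, z (ι n) = w (ι n)) :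
    cantorMeasure s = 0 := by
  refine le_antisymm (ge_of_tendsto' (ENNReal.tendsto_pow_atTop_nhds_zero_of_lt_one
    (ENNReal.inv_lt_one.2 ENNReal.one_lt_two)) fun m => ?_) zero_le
  have := cantorMeasure_cylinder ((Finset.range m).map ⟨ι, hι⟩) w
  rw [Finset.card_map, Finset.card_range] at this
  rw [← this]
  refine measure_mono fun z hz => ?_
  simpa using fun n _ => h z hz n

lemma cantorMeasure_evenZero : cantorMeasure evenZero = 0 :=
  cantorMeasure_eq_zero_of_forall _ (fun _ => false)
    (mul_right_injective₀ (two_ne_zero (α := ℕ))) fun _ hz => hz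

instance : NullSingletonClass cantorMeasure :=
  ⟨fun w => cantorMeasure_eq_zero_of_forall _ w Function.injective_id fun z hz n => by
    rw [mem_singleton_iff.1 hz]⟩

/-- Every atomless probability measure on a standard Borel space is carried to `ν` by a map which
is injective everywhere, not merely almost everywhere, with a measurable left inverse. -/
lemma exists_embedding_cantorMeasure {X : Type*} [MeasurableSpace X] [StandardBorelSpace X]
    (ρ : Measure X) [IsProbabilityMeasure ρ] [NullSingletonClass ρ] :
    ∃ (ψ : X → Cantor) (r : Cantor → X), Measurable ψ ∧ Measurable r ∧
      Function.LeftInverse r ψ ∧ ρ.map ψ = cantorMeasure := by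
  classical
  have : Nonempty X := nonempty_of_isProbabilityMeasure ρ
  obtain ⟨U, V, hU, hV, hUl, hVU⟩ := exists_uniform_coordinate ρ
  obtain ⟨U', V', hU', hV', hUl', hVU'⟩ := exists_uniform_coordinate cantorMeasure
  have hσ : Measurable fun x => V' (U x) := hV'.comp hU
  have hτ : Measurable fun z => V (U' z) := hV.comp hU'
  have hmap : ρ.map (fun x => V' (U x)) = cantorMeasure := by
    have h1 : ρ.map (fun x => V' (U x)) = (ρ.map U).map V' := (Measure.map_map hV' hU).symm
    have h2 : V' ∘ U' =ᵐ[cantorMeasure] id := hVU'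
    rw [h1, hUl, ← hUl', Measure.map_map hV' hU', Measure.map_congr h2, Measure.map_id]
  -- `U' ∘ V'` is the identity almost everywhere for the uniform law
  have hUV : ∀ᵐ x ∂ρ, U' (V' (U x)) = U x := by
    have hms : MeasurableSet {u : ℝ | U' (V' u) = u} :=
      measurableSet_eq_fun (hU'.comp hV') measurable_id
    have h1 : ∀ᵐ u ∂(cantorMeasure.map U'), U' (V' u) = u := by
      rw [ae_map_iff hU'.aemeasurable hms]
      filter_upwards [hVU'] with z hz
      rw [hz]
    rw [hUl', ← hUl, ae_map_iff hU.aemeasurable hms] at h1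
    exact h1
  have hτσ : ∀ᵐ x ∂ρ, V (U' (V' (U x))) = x := by
    filter_upwards [hUV, hVU] with x h1 h2
    rw [h1, h2]
  -- the exceptional points are sent into a null set by an unrelated embedding
  obtain ⟨em, hem⟩ : ∃ em : X → Cantor, MeasurableEmbedding em :=
    ⟨_, (MeasurableSpace.measurable_mapNatBool X).measurableEmbedding
      (MeasurableSpace.injective_mapNatBool X)⟩
  obtain ⟨d, hd, hde⟩ := hem.exists_measurable_extend measurable_id (fun _ => ‹Nonempty X›)
  set ι : X → Cantor := fun x n => if n % 2 = 0 then false else em x (n / 2) with hι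
  set κ : Cantor → X := fun z => d fun n => z (2 * n + 1) with hκ
  have hιm : Measurable ι := by
    refine measurable_pi_lambda _ fun n => ?_
    by_cases hn : n % 2 = 0
    · simp only [hι, hn, if_true]; exact measurable_const
    · simp only [hι, hn, if_false]; exact (measurable_pi_apply _).comp hem.measurable
  have hκm : Measurable κ := hd.comp (measurable_pi_lambda _ fun n => measurable_pi_apply _)
  have hκι : ∀ x, κ (ι x) = x := fun x => by
    have : (fun n => ι x (2 * n + 1)) = em x := by
      funext n
      have h1 : ¬ (2 * n + 1) % 2 = 0 := by omega
      have h2 : (2 * n + 1) / 2 = n := by omega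
      simp only [hι, h1, if_false, h2]
    simp only [hκ, this]
    exact congrFun hde x
  have hιT : ∀ x, ι x ∈ evenZero := fun x n => by simp [hι]
  set G : Set X := {x | V (U' (V' (U x))) = x ∧ V' (U x) ∉ evenZero} with hG
  have hGm : MeasurableSet G := by
    obtain ⟨e, he⟩ := exists_measurableEmbedding_real X
    have h1 : {x | V (U' (V' (U x))) = x} = {x | e (V (U' (V' (U x)))) = e x} := by
      ext x; exact he.injective.eq_iff.symm
    have h2 : MeasurableSet {x | V (U' (V' (U x))) = x} := by
      rw [h1]
      exact measurableSet_eq_fun (he.measurable.comp (hτ.comp hσ)) he.measurable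
    exact h2.inter (hσ measurableSet_evenZero).compl
  have hGae : ∀ᵐ x ∂ρ, x ∈ G := by
    have h0 : ∀ᵐ x ∂ρ, V' (U x) ∉ evenZero := by
      have h := cantorMeasure_evenZero
      rw [← hmap, Measure.map_apply hσ measurableSet_evenZero] at h
      exact measure_eq_zero_iff_ae_notMem.1 h
    filter_upwards [hτσ, h0] with x h1 h2 using ⟨h1, h2⟩
  refine ⟨G.piecewise (fun x => V' (U x)) ι, evenZero.piecewise κ fun z => V (U' z),
    hσ.piecewise hGm hιm, hκm.piecewise measurableSet_evenZero hτ, fun x => ?_, ?_⟩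
  · by_cases hx : x ∈ G
    · rw [piecewise_eq_of_mem _ _ _ hx, piecewise_eq_of_notMem _ _ _ hx.2]
      exact hx.1
    · rw [piecewise_eq_of_notMem _ _ _ hx, piecewise_eq_of_mem _ _ _ (hιT x)]
      exact hκι x
  · rw [← hmap]
    refine Measure.map_congr ?_
    filter_upwards [hGae] with x hx
    exact piecewise_eq_of_mem _ _ _ hx

/-! ### Transferring a limit object to the Cantor space -/

/-- A symmetric measure over an arbitrary standard Borel probability space `(K, ρ)` has the same
quotient matrices as some symmetric measure over `(Cantor, ν)`. The space `K` is first multiplied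
with `Cantor` to remove atoms; averaging over the new coordinate does not change the matrices. -/
lemma exists_symMeasure_of_standardBorel {K : Type*} [MeasurableSpace K] [StandardBorelSpace K]
    (ρ : Measure K) [IsProbabilityMeasure ρ] (μ : Measure (K × K)) (hs : μ.map Prod.swap = μ)
    {c : ℝ} (hμ : μ univ ≤ ENNReal.ofReal c) :
    ∃ μ' : SymMeasure c, ∀ (k : ℕ) (α : Fin k → ℝ),
      quotientMatrix μ'.1 '' fracPartitions α =
        quotientMatrixOn μ '' fracPartitionsOn ρ α := by
  have : IsFiniteMeasure μ := ⟨lt_of_le_of_lt hμ ENNReal.ofReal_lt_top⟩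
  obtain ⟨ψ, r, hψ, hr, hrψ, hmap⟩ := exists_embedding_cantorMeasure (ρ.prod cantorMeasure)
  set θ : (K × K) × (Cantor × Cantor) → Cantor × Cantor :=
    fun w => (ψ (w.1.1, w.2.1), ψ (w.1.2, w.2.2)) with hθ
  have hθm : Measurable θ := by fun_prop
  set π := μ.prod (cantorMeasure.prod cantorMeasure) with hπ
  have hsymm : (π.map θ).map Prod.swap = π.map θ := by
    have h1 : π.map (Prod.map Prod.swap Prod.swap) = π := by
      rw [hπ, ← Measure.map_prod_map _ _ measurable_swap measurable_swap, hs, Measure.prod_swap]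
    rw [Measure.map_map measurable_swap hθm]
    have h2 : Prod.swap ∘ θ = θ ∘ Prod.map Prod.swap Prod.swap := by
      funext w; rfl
    rw [h2, ← Measure.map_map hθm (measurable_swap.prodMap measurable_swap), h1]
  have hmass : π.map θ univ ≤ ENNReal.ofReal c := by
    rw [Measure.map_apply hθm .univ, preimage_univ, hπ, ← univ_prod_univ, Measure.prod_prod,
      measure_univ (μ := cantorMeasure.prod cantorMeasure), mul_one]
    exact hμ
  refine ⟨⟨π.map θ, hsymm, hmass⟩, fun k α => Subset.antisymm ?_ ?_⟩
  · rintro _ ⟨f, hf, rfl⟩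
    rw [fracPartitions_eq] at hf
    have hfψ : IsFracPartition fun i x => f i (ψ x) := hf.1.comp hψ
    have hsec : ∀ x, IsFracPartition fun i s => f i (ψ (x, s)) := fun x =>
      hf.1.comp (hψ.comp measurable_prodMk_left)
    refine ⟨fun i x => ∫ s, f i (ψ (x, s)) ∂cantorMeasure, ⟨⟨fun i => ?_, fun i x => ?_,
      fun x => ?_⟩, fun i => ?_⟩, ?_⟩
    · exact ((hfψ.measurable i).stronglyMeasurable.integral_prod_right').measurable
    · exact integral_nonneg fun s => hf.1.nonneg i _
    · exact (hsec x).sum_integral cantorMeasure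
    · have h1 := integral_map (μ := ρ.prod cantorMeasure) hψ.aemeasurable
        (hf.1.measurable i).aestronglyMeasurable
      rw [hmap, hf.2 i] at h1
      rw [← integral_prod _ (hfψ.integrable _ i), h1]
    · ext i j
      simp only [quotientMatrix, quotientMatrixOn, Matrix.of_apply]
      rw [integral_map hθm.aemeasurable (hf.1.measurable_mul i j).aestronglyMeasurable, hπ,
        integral_prod]
      · refine integral_congr_ae (Eventually.of_forall fun z => ?_)
        exact (integral_prod_mul (fun s => f i (ψ (z.1, s))) fun s => f j (ψ (z.2, s))).symm
      · exact (hf.1.integrable_mul (π.map θ) i j).comp_measurable hθm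
  · rintro _ ⟨f, hf, rfl⟩
    have hg : IsFracPartition fun i z => f i (r z).1 := hf.1.comp (measurable_fst.comp hr)
    refine ⟨fun i z => f i (r z).1, ?_, ?_⟩
    · rw [fracPartitions_eq]
      refine ⟨hg, fun i => ?_⟩
      have h1 := integral_map (μ := ρ.prod cantorMeasure) hψ.aemeasurable
        (hg.measurable i).aestronglyMeasurable
      rw [hmap] at h1
      rw [h1]
      simp only [hrψ _]
      rw [integral_prod _ ((hf.1.comp measurable_fst).integrable _ i), ← hf.2 i]
      simp
    · ext i j
      simp only [quotientMatrix, quotientMatrixOn, Matrix.of_apply]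
      rw [integral_map hθm.aemeasurable (hg.measurable_mul i j).aestronglyMeasurable]
      simp only [hθ, hrψ _]
      have h1 := integral_prod (μ := μ) (ν := cantorMeasure.prod cantorMeasure)
        (fun w => f i w.1.1 * f j w.1.2) ((hf.1.integrable_mul μ i j).comp_fst _)
      rw [hπ, h1]
      simp

/-! ### Weak limits and continuous fractional partitions -/

section WeakLimit

variable {K : Type*} [TopologicalSpace K] [CompactSpace K] [PolishSpace K]
  [MeasurableSpace K] [BorelSpace K]

/-- The images of `ν` and of measures of bounded mass under maps to a compact space `K`
converge weakly along every ultrafilter. -/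
lemma exists_weak_limit {ι : Type*} (l : Ultrafilter ι) {c : ℝ} (μ : ι → SymMeasure c)
    (φ : ι → Cantor → K) (hφ : ∀ n, Measurable (φ n)) :
    ∃ (ρ : Measure K) (μ' : Measure (K × K)), IsProbabilityMeasure ρ ∧
      μ'.map Prod.swap = μ' ∧ μ' univ ≤ ENNReal.ofReal c ∧
      (∀ g : K → ℝ, Continuous g →
        Tendsto (fun n => ∫ x, g (φ n x) ∂cantorMeasure) l (𝓝 (∫ x, g x ∂ρ))) ∧
      ∀ g : K × K → ℝ, Continuous g →
        Tendsto (fun n => ∫ z, g (φ n z.1, φ n z.2) ∂(μ n).1) l (𝓝 (∫ z, g z ∂μ')) := by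
  have hφ2 : ∀ n, Measurable fun z : Cantor × Cantor => (φ n z.1, φ n z.2) := fun n =>
    ((hφ n).comp measurable_fst).prodMk ((hφ n).comp measurable_snd)
  -- the limit of the images of `ν`
  have hprob : ∀ n, IsProbabilityMeasure (cantorMeasure.map (φ n)) := fun n =>
    Measure.isProbabilityMeasure_map (hφ n).aemeasurable
  let P : ι → ProbabilityMeasure K := fun n => ⟨_, hprob n⟩
  obtain ⟨ρ, -, hρ⟩ := isCompact_univ.ultrafilter_le_nhds (l.map P) (by simp)
  have hρ' : Tendsto P l (𝓝 ρ) := hρ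
  rw [ProbabilityMeasure.tendsto_iff_forall_integral_tendsto] at hρ'
  -- the limit of the images of the measures `μ n`
  have hfin : ∀ n, IsFiniteMeasure ((μ n).1.map fun z => (φ n z.1, φ n z.2)) := fun n =>
    inferInstance
  let Q : ι → FiniteMeasure (K × K) := fun n => ⟨_, hfin n⟩
  have hmass : ∀ n, (Q n).mass ≤ c.toNNReal := fun n => by
    rw [← ENNReal.coe_le_coe, FiniteMeasure.ennreal_mass]
    change (Measure.map _ _) univ ≤ _
    rw [Measure.map_apply (hφ2 n) .univ, preimage_univ]
    exact (μ n).2.2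
  obtain ⟨m, hm, hlim⟩ :=
    (isCompact_setOfPred_finiteMeasure_le_of_compactSpace (K × K) c.toNNReal).ultrafilter_le_nhds'
      (l.map Q) (Filter.mem_map.2 (Filter.univ_mem' hmass))
  have hlim' : Tendsto Q l (𝓝 m) := hlim
  rw [FiniteMeasure.tendsto_iff_forall_integral_tendsto] at hlim'
  have hμlim : ∀ g : K × K → ℝ, Continuous g →
      Tendsto (fun n => ∫ z, g (φ n z.1, φ n z.2) ∂(μ n).1) l
        (𝓝 (∫ z, g z ∂(m : Measure (K × K)))) := fun g hg => by
    refine (hlim' (BoundedContinuousFunction.mkOfCompact ⟨g, hg⟩)).congr fun n => ?_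
    exact integral_map (hφ2 n).aemeasurable hg.measurable.aestronglyMeasurable
  refine ⟨ρ, m, inferInstance, ?_, ?_, fun g hg => ?_, hμlim⟩
  · refine ext_of_forall_integral_eq_of_IsFiniteMeasure fun g => ?_
    rw [integral_map measurable_swap.aemeasurable g.continuous.measurable.aestronglyMeasurable]
    refine tendsto_nhds_unique (hμlim _ (g.continuous.comp continuous_swap))
      ((hμlim g g.continuous).congr fun n => ?_)
    conv_lhs => rw [← (μ n).2.1]
    exact integral_map measurable_swap.aemeasurable
      (g.continuous.measurable.comp (hφ2 n)).aestronglyMeasurable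
  · have : ((m.mass : NNReal) : ENNReal) ≤ (c.toNNReal : NNReal) := ENNReal.coe_le_coe.2 hm
    rwa [FiniteMeasure.ennreal_mass] at this
  · refine (hρ' (BoundedContinuousFunction.mkOfCompact ⟨g, hg⟩)).congr fun n => ?_
    exact integral_map (hφ n).aemeasurable hg.measurable.aestronglyMeasurable


/-- Fractional partitions can be approximated by continuous ones in `L¹`: approximate the single
functions, take positive parts, and normalize. -/
lemma IsFracPartition.exists_continuous {k : ℕ} {f : Fin k → K → ℝ} (hf : IsFracPartition f)
    (ρ : Measure K) [IsFiniteMeasure ρ] {ε : ℝ} (hε : 0 < ε) :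
    ∃ h : Fin k → K → ℝ, IsFracPartition h ∧ (∀ i, Continuous (h i)) ∧
      ∀ i, ∫ x, |f i x - h i x| ∂ρ ≤ ε := by
  choose g hg hgi using fun i => (hf.integrable ρ i).exists_boundedContinuous_integral_sub_le
    (ε := ε / (k + 1)) (by positivity)
  set u : Fin k → K → ℝ := fun i x => max (g i x) 0 with hu
  set s : K → ℝ := fun x => ∑ i, u i x with hs
  set h : Fin k → K → ℝ := fun i x => u i x / max (s x) 1 + (1 - s x / max (s x) 1) / k with hh
  have huc : ∀ i, Continuous (u i) := fun i => (g i).continuous.max continuous_const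
  have hsc : Continuous s := continuous_finsetSum _ fun i _ => huc i
  have hm : ∀ x, 0 < max (s x) 1 := fun x => lt_max_of_lt_right one_pos
  have hhc : ∀ i, Continuous (h i) := fun i =>
    ((huc i).div (hsc.max continuous_const) fun x => (hm x).ne').add
      ((continuous_const.sub (hsc.div (hsc.max continuous_const) fun x => (hm x).ne')).div_const _)
  have hu0 : ∀ i x, 0 ≤ u i x := fun i x => le_max_right _ _
  have hsle : ∀ x, s x / max (s x) 1 ≤ 1 := fun x => (div_le_one (hm x)).2 (le_max_left _ _)
  have hk : ∀ _ : K, (k : ℝ) ≠ 0 := fun x hk => by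
    have h1 := hf.sum_eq x
    obtain rfl : k = 0 := by exact_mod_cast hk
    simp at h1
  have hpart : IsFracPartition h := by
    refine ⟨fun i => (hhc i).measurable, fun i x => ?_, fun x => ?_⟩
    · exact add_nonneg (div_nonneg (hu0 i x) (hm x).le)
        (div_nonneg (sub_nonneg.2 (hsle x)) k.cast_nonneg)
    · have hk' := hk x
      simp only [hh, Finset.sum_add_distrib, ← Finset.sum_div, Finset.sum_const, Finset.card_univ,
        Fintype.card_fin, nsmul_eq_mul]
      rw [mul_div_cancel_left₀ _ hk']
      change s x / _ + _ = 1
      ring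
  have hbound : ∀ i x, |f i x - h i x| ≤ ‖f i x - g i x‖ + ∑ j, ‖f j x - g j x‖ := fun i x => by
    have h1 : ∀ j, |f j x - u j x| ≤ ‖f j x - g j x‖ := fun j => by
      have := abs_max_sub_max_le_abs (f j x) (g j x) 0
      rwa [max_eq_left (hf.nonneg j x)] at this
    have h2 : |1 - s x| ≤ ∑ j, ‖f j x - g j x‖ := by
      rw [← hf.sum_eq x, hs, ← Finset.sum_sub_distrib]
      exact (Finset.abs_sum_le_sum_abs _ _).trans (Finset.sum_le_sum fun j _ => h1 j)
    have h3 : |u i x - h i x| ≤ |1 - s x| := by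
      have hk1 : (1 : ℝ) ≤ k := by
        have := hk x
        exact_mod_cast Nat.one_le_iff_ne_zero.2 (by exact_mod_cast this)
      rcases le_total (s x) 1 with hle | hle
      · have e : u i x - h i x = -((1 - s x) / k) := by
          simp only [hh, max_eq_right hle]; ring
        rw [e, abs_neg, abs_of_nonneg (div_nonneg (sub_nonneg.2 hle) k.cast_nonneg),
          abs_of_nonneg (sub_nonneg.2 hle)]
        exact div_le_self (sub_nonneg.2 hle) hk1
      · have hs0 : 0 < s x := one_pos.trans_le hle
        have e : u i x - h i x = u i x / s x * (s x - 1) := by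
          simp only [hh, max_eq_left hle]; field_simp; ring
        have hus : u i x ≤ s x :=
          Finset.single_le_sum (f := fun i => u i x) (fun j _ => hu0 j x) (Finset.mem_univ i)
        rw [e, abs_sub_comm 1, abs_of_nonneg (sub_nonneg.2 hle),
          abs_of_nonneg (mul_nonneg (div_nonneg (hu0 i x) hs0.le) (sub_nonneg.2 hle))]
        exact mul_le_of_le_one_left (sub_nonneg.2 hle) ((div_le_one hs0).2 hus)
    calc |f i x - h i x| ≤ |f i x - u i x| + |u i x - h i x| := abs_sub_le _ _ _
      _ ≤ _ := add_le_add (h1 i) (h3.trans h2)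
  refine ⟨h, hpart, hhc, fun i => ?_⟩
  have hint : ∀ j, Integrable (fun x => ‖f j x - g j x‖) ρ := fun j =>
    ((hf.integrable ρ j).sub (hgi j)).norm
  calc ∫ x, |f i x - h i x| ∂ρ ≤ ∫ x, (‖f i x - g i x‖ + ∑ j, ‖f j x - g j x‖) ∂ρ :=
        integral_mono ((hf.integrable ρ i).sub (hpart.integrable ρ i)).abs
          ((hint i).add (integrable_finsetSum _ fun j _ => hint j)) (hbound i)
    _ = ∫ x, ‖f i x - g i x‖ ∂ρ + ∑ j, ∫ x, ‖f j x - g j x‖ ∂ρ := by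
        rw [integral_add (hint i) (integrable_finsetSum _ fun j _ => hint j),
          integral_finsetSum _ fun j _ => hint j]
    _ ≤ ε / (k + 1) + ∑ _j : Fin k, ε / (k + 1) :=
        add_le_add (hg i) (Finset.sum_le_sum fun j _ => hg j)
    _ = ε := by
        rw [Finset.sum_const, Finset.card_univ, Fintype.card_fin, nsmul_eq_mul]
        field_simp
        ring

/-- Quotient matrices of a weak limit are limits of quotient matrices along the ultrafilter,
with the same vector `α` of integrals. -/
lemma eventually_exists_quotientMatrix_close {ι : Type*} {l : Filter ι} {c : ℝ}
    (hc : 0 ≤ c) {μ : ι → SymMeasure c} {φ : ι → Cantor → K} (hφ : ∀ n, Measurable (φ n))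
    {ρ : Measure K} [IsProbabilityMeasure ρ] {μ' : Measure (K × K)} [IsFiniteMeasure μ']
    (hρ : ∀ g : K → ℝ, Continuous g →
      Tendsto (fun n => ∫ x, g (φ n x) ∂cantorMeasure) l (𝓝 (∫ x, g x ∂ρ)))
    (hμ : ∀ g : K × K → ℝ, Continuous g →
      Tendsto (fun n => ∫ z, g (φ n z.1, φ n z.2) ∂(μ n).1) l (𝓝 (∫ z, g z ∂μ')))
    {k : ℕ} {α : Fin k → ℝ} (hα : ∀ i, 0 < α i) {f : Fin k → K → ℝ}
    (hf : f ∈ fracPartitionsOn ρ α) {ε : ℝ} (hε : 0 < ε) :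
    ∀ᶠ n in l, ∃ f' ∈ fracPartitions α,
      ∀ i j, |quotientMatrix (μ n).1 f' i j - quotientMatrixOn μ' f i j| ≤ ε := by
  have hα1 : ∑ i, α i = 1 := by
    simp only [← hf.2]; exact hf.1.sum_integral ρ
  -- `δ` bounds the relative error of the integrals
  obtain ⟨δ, hδ0, hδ1, hδ⟩ := exists_correction_size hc hε
  obtain ⟨κ, hκ0, hκ⟩ : ∃ κ : ℝ, 0 < κ ∧ ∀ i, κ ≤ δ * α i / 2 := by
    rcases isEmpty_or_nonempty (Fin k) with h | h
    · exact ⟨1, one_pos, fun i => isEmptyElim i⟩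
    · obtain ⟨i0, hi0⟩ := Finite.exists_min α
      exact ⟨δ * α i0 / 2, by have := hα i0; positivity, fun i => by
        have := mul_le_mul_of_nonneg_left (hi0 i) hδ0.le; linarith⟩
  -- a continuous approximation, with respect to all measures that matter at once
  obtain ⟨h, hh, hhc, hfh⟩ := hf.1.exists_continuous (ρ + (μ'.map Prod.fst + μ'.map Prod.snd))
    (ε := min κ (ε / 6)) (by positivity)
  have hle : ∀ (σ : Measure K) [IsFiniteMeasure σ],
      σ ≤ ρ + (μ'.map Prod.fst + μ'.map Prod.snd) → ∀ i,
      ∫ x, |f i x - h i x| ∂σ ≤ min κ (ε / 6) := fun σ _ hσ i =>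
    (integral_mono_measure hσ (Eventually.of_forall fun x => abs_nonneg _)
      ((hf.1.integrable _ i).sub (hh.integrable _ i)).abs).trans (hfh i)
  have h1 : ∀ i, ∫ x, h i x ∂ρ ≤ α i + κ := fun i => by
    have := (abs_integral_le_integral_abs (f := fun x => f i x - h i x)).trans
      ((hle ρ (Measure.le_add_right le_rfl) i).trans (min_le_left _ _))
    rw [integral_sub (hf.1.integrable ρ i) (hh.integrable ρ i), hf.2 i, abs_le] at this
    linarith
  have h2 : ∀ i j, |quotientMatrixOn μ' f i j - quotientMatrixOn μ' h i j| ≤ ε / 3 :=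
    fun i j => by
      have e1 := hle (μ'.map Prod.fst)
        (Measure.le_add_left (Measure.le_add_right le_rfl)) i
      have e2 := hle (μ'.map Prod.snd)
        (Measure.le_add_left (Measure.le_add_left le_rfl)) j
      have e3 := min_le_right κ (ε / 6)
      linarith [hf.1.abs_quotientMatrixOn_sub_le hh μ' i j]
  have h3 : ∀ᶠ n in l, ∀ i, ∫ x, h i (φ n x) ∂cantorMeasure ≤ (1 + δ) * α i := by
    refine eventually_all.2 fun i => ?_
    refine (hρ (h i) (hhc i)).eventually_le_const ?_
    have e1 := hκ i
    have e2 := mul_pos hδ0 (hα i)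
    linarith [h1 i]
  have h4 : ∀ᶠ n in l, ∀ i j, |quotientMatrix (μ n).1 (fun i x => h i (φ n x)) i j -
      quotientMatrixOn μ' h i j| ≤ ε / 3 := by
    refine eventually_all.2 fun i => eventually_all.2 fun j => ?_
    have hc2 : Continuous fun z : K × K => h i z.1 * h j z.2 :=
      ((hhc i).comp continuous_fst).mul ((hhc j).comp continuous_snd)
    have := (tendsto_iff_dist_tendsto_zero.1 (hμ _ hc2)).eventually_le_const
      (show 0 < ε / 3 by positivity)
    exact this
  filter_upwards [h3, h4] with n hn3 hn4
  obtain ⟨f', hf', hclose⟩ := (hh.comp (hφ n)).exists_mem_fracPartitionsOn cantorMeasure hα1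
    hδ0.le hδ1 hn3
  refine ⟨f', mem_fracPartitions_iff.2 hf', fun i j => ?_⟩
  have h5 := hf'.1.abs_quotientMatrixOn_sub_le_of_forall (hh.comp (hφ n)) (μ n).1 hclose i j
  have h6 : 2 * δ * (μ n).1.real univ ≤ ε / 3 :=
    (mul_le_mul_of_nonneg_left ((μ n).real_univ_le hc) (by positivity)).trans hδ
  rw [quotientMatrix_eq] at hn4 ⊢
  have h7 := h2 i j
  rw [abs_sub_comm] at h7
  calc _ ≤ _ + _ := abs_sub_le _ (quotientMatrixOn (μ n).1 (fun i x => h i (φ n x)) i j) _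
    _ ≤ _ + (_ + _) := add_le_add_right (abs_sub_le _ (quotientMatrixOn μ' h i j) _) _
    _ ≤ ε / 3 + (ε / 3 + ε / 3) := add_le_add (h5.trans h6) (add_le_add (hn4 i j) h7)
    _ = ε := by ring

end WeakLimit

/-! ### Compactness of the space of measures with the shape metric -/

/-- A criterion for convergence in the Hausdorff distance inside a totally bounded set: points
of the limit are limits of points, and the distances to the points of a dense sequence do not
drop in the limit. -/
lemma eventually_hausdorffDist_le {E ι : Type*} [PseudoMetricSpace E] {l : Filter ι}
    {S : ι → Set E} {T B : Set E} (hB : TotallyBounded B) (hS : ∀ n, S n ⊆ B) (hT : T ⊆ B)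
    (hTn : T.Nonempty) {q : ℕ → E} (hq : DenseRange q)
    (h1 : ∀ y ∈ T, ∀ ε > 0, ∀ᶠ n in l, ∃ x ∈ S n, dist y x ≤ ε)
    (h2 : ∀ m, ∀ ε > 0, ∀ᶠ n in l,
      Metric.infDist (q m) T ≤ Metric.infDist (q m) (S n) + ε) {ε : ℝ} (hε : 0 < ε) :
    ∀ᶠ n in l, Metric.hausdorffDist (S n) T ≤ ε := by
  obtain ⟨t, htT, htf, ht⟩ :=
    totallyBounded_iff_subset.1 (hB.subset hT) _ (Metric.dist_mem_uniformity (half_pos hε))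
  obtain ⟨b, hbf, hb⟩ := Metric.totallyBounded_iff.1 hB (ε / 6) (by positivity)
  choose m hm using fun y : E => hq.exists_dist_lt y (show 0 < ε / 6 by positivity)
  have e1 : ∀ᶠ n in l, ∀ y ∈ t, ∃ x ∈ S n, dist y x ≤ ε / 2 :=
    htf.eventually_all.2 fun y hy => h1 y (htT hy) _ (half_pos hε)
  have e2 : ∀ᶠ n in l, ∀ y ∈ b,
      Metric.infDist (q (m y)) T ≤ Metric.infDist (q (m y)) (S n) + ε / 6 :=
    hbf.eventually_all.2 fun y _ => h2 _ _ (by positivity)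
  filter_upwards [e1, e2] with n hn1 hn2
  refine Metric.hausdorffDist_le_of_mem_dist hε.le (fun x hx => ?_) fun y hy => ?_
  · obtain ⟨y, hy, hxy⟩ := mem_iUnion₂.1 (hb (hS n hx))
    have d1 : dist (q (m y)) x < ε / 3 := by
      have := dist_triangle_left (q (m y)) x y
      have h3 := hm y
      rw [Metric.mem_ball, dist_comm] at hxy
      linarith
    have d2 : Metric.infDist (q (m y)) T < 2 * ε / 3 := by
      have := (Metric.infDist_le_dist_of_mem (x := q (m y)) hx)
      have h3 := hn2 y hy
      linarith
    obtain ⟨z, hz, hzd⟩ := (Metric.infDist_lt_iff hTn).1 d2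
    refine ⟨z, hz, ?_⟩
    have := dist_triangle_left x z (q (m y))
    linarith
  · obtain ⟨z, hz, hyz⟩ := mem_iUnion₂.1 (ht hy)
    obtain ⟨x, hx, hzx⟩ := hn1 z hz
    refine ⟨x, hx, ?_⟩
    have hyz' : dist y z < ε / 2 := hyz
    have := dist_triangle y z x
    linarith

lemma matrixHausdorffDist_nonneg {k : ℕ} (A B : Set (Matrix (Fin k) (Fin k) ℝ)) :
    0 ≤ matrixHausdorffDist A B := Metric.hausdorffDist_nonneg

lemma image_shape_subset (μ : Measure (Cantor × Cantor)) (k : ℕ) :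
    toEllOne '' shape μ k ⊆
      closure (toEllOne '' (quotientMatrix μ '' fracPartitions fun _ : Fin k => 1 / (k : ℝ))) :=
  image_closure_subset_closure_image (toEllOne_continuous k)

/-- Nearly optimal approximation of a point by quotient matrices. -/
lemma exists_fracPartition_dist_le (μ : Measure (Cantor × Cantor)) (k : ℕ)
    (q : PiLp 1 (fun _ : Fin (k + 1) × Fin (k + 1) => ℝ)) {ε : ℝ} (hε : 0 < ε) :
    ∃ f ∈ fracPartitions (fun _ : Fin (k + 1) => 1 / ((k + 1 : ℕ) : ℝ)),
      dist q (toEllOne (quotientMatrix μ f)) ≤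
        Metric.infDist q (toEllOne '' shape μ (k + 1)) + ε := by
  have h1 := Metric.infDist_le_infDist_of_subset (x := q) (image_shape_subset μ (k + 1))
    ((shape_nonempty μ k).image _)
  rw [Metric.infDist_closure] at h1
  have hne : (toEllOne '' (quotientMatrix μ ''
      fracPartitions fun _ : Fin (k + 1) => 1 / ((k + 1 : ℕ) : ℝ))).Nonempty :=
    ((closure_nonempty_iff.1 (shape_nonempty μ k))).image _
  obtain ⟨_, ⟨_, ⟨f, hf, rfl⟩, rfl⟩, hd⟩ :=
    (Metric.infDist_lt_iff hne).1 (lt_of_le_of_lt h1 (lt_add_of_pos_right _ hε))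
  exact ⟨f, hf, hd.le⟩

/-- Convergence in the shape metric is convergence of all shapes. -/
lemma tendsto_of_forall_matrixHausdorffDist {ι : Type*} {l : Filter ι} {c : ℝ}
    {u : ι → SymMeasure c} {μ : SymMeasure c}
    (h : ∀ k, Tendsto (fun n => matrixHausdorffDist (shape (u n).1 (k + 1)) (shape μ.1 (k + 1))) l
      (𝓝 0)) : Tendsto u l (𝓝 μ) := by
  rw [tendsto_iff_dist_tendsto_zero]
  have hg : Summable fun k : ℕ => (1 / 2 : ℝ) ^ (k + 1) * (2 * max c 0) :=
    ((summable_nat_add_iff 1).2 summable_geometric_two).mul_right _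
  have := tendsto_tsum_of_dominated_convergence (𝓕 := l) (g := fun _ : ℕ => (0 : ℝ)) hg
    (f := fun n k => (1 / 2 : ℝ) ^ (k + 1) *
      matrixHausdorffDist (shape (u n).1 (k + 1)) (shape μ.1 (k + 1)))
    (fun k => by simpa using! (h k).const_mul ((1 / 2 : ℝ) ^ (k + 1)))
    (Eventually.of_forall fun n k => by
      rw [Real.norm_of_nonneg (mul_nonneg (by positivity) (matrixHausdorffDist_nonneg _ _))]
      exact mul_le_mul_of_nonneg_left (matrixHausdorffDist_shape_le _ _ k) (by positivity))
  rwa [tsum_zero] at this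

/-- The compact space in which the limit objects live: the factor of index `(k, m, j)` is the
simplex of possible values of a fractional partition into `k + 1` functions. -/
abbrev SimplexProduct : Type := (a : Σ _ : ℕ, ℕ × ℕ) → stdSimplex ℝ (Fin (a.1 + 1))

instance (k : ℕ) : PolishSpace (stdSimplex ℝ (Fin (k + 1))) :=
  (isClosed_stdSimplex (𝕜 := ℝ) (Fin (k + 1))).polishSpace

lemma isFracPartition_coordinate (a : Σ _ : ℕ, ℕ × ℕ) :
    IsFracPartition fun (i : Fin (a.1 + 1)) (z : SimplexProduct) => (z a).1 i :=
  ⟨fun i => ((measurable_pi_apply i).comp measurable_subtype_coe).comp (measurable_pi_apply a),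
    fun i z => (z a).2.1 i, fun z => (z a).2.2⟩

lemma continuous_coordinate (a : Σ _ : ℕ, ℕ × ℕ) (i : Fin (a.1 + 1)) :
    Continuous fun z : SimplexProduct => (z a).1 i :=
  ((continuous_apply i).comp continuous_subtype_val).comp (continuous_apply a)

/-- The whole space `𝓜⁺_c` is compact. Along an ultrafilter, countably many fractional partitions
exhausting all shapes are carried to the coordinates of a product of simplices, where a weak limit
exists; the limit is carried back to the Cantor space. -/
theorem isCompact_univ_symMeasure {c : ℝ} (hc : 0 ≤ c) :
    IsCompact (univ : Set (SymMeasure c)) := by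
  refine isCompact_iff_ultrafilter_le_nhds.2 fun l _ => ?_
  let q : (k : ℕ) → ℕ → PiLp 1 (fun _ : Fin (k + 1) × Fin (k + 1) => ℝ) := fun k =>
    TopologicalSpace.denseSeq _
  have hq : ∀ k, DenseRange (q k) := fun k => TopologicalSpace.denseRange_denseSeq _
  choose F hF hFd using fun (n : SymMeasure c) (a : Σ _ : ℕ, ℕ × ℕ) =>
    exists_fracPartition_dist_le n.1 a.1 (q a.1 a.2.1) (ε := 1 / ((a.2.2 : ℝ) + 1))
      (by positivity)
  let φ : SymMeasure c → Cantor → SimplexProduct := fun n x a =>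
    ⟨fun i => F n a i x, fun i => (hF n a).2.1 i x, (hF n a).2.2.1 x⟩
  have hφ : ∀ n, Measurable (φ n) := fun n => by
    refine measurable_pi_lambda _ fun a => Measurable.subtype_mk ?_
    exact measurable_pi_lambda _ fun i => (hF n a).1 i
  obtain ⟨ρ, μ', hρ, hs, hm, hlim1, hlim2⟩ := exists_weak_limit l (fun n => n) φ hφ
  have : IsFiniteMeasure μ' := ⟨lt_of_le_of_lt hm ENNReal.ofReal_lt_top⟩
  obtain ⟨μ, hμ⟩ := exists_symMeasure_of_standardBorel ρ μ' hs hm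
  refine ⟨μ, mem_univ _, ?_⟩
  change Tendsto (fun n => n) (l : Filter (SymMeasure c)) (𝓝 μ)
  refine tendsto_of_forall_matrixHausdorffDist fun k => ?_
  -- the coordinates of index `a` give limits of the chosen quotient matrices
  have hcoord : ∀ a : Σ _ : ℕ, ℕ × ℕ,
      (fun (i : Fin (a.1 + 1)) (z : SimplexProduct) => (z a).1 i) ∈
        fracPartitionsOn ρ fun _ : Fin (a.1 + 1) => 1 / ((a.1 + 1 : ℕ) : ℝ) := fun a => by
    refine ⟨isFracPartition_coordinate a, fun i => ?_⟩
    refine tendsto_nhds_unique (hlim1 _ (continuous_coordinate a i)) ?_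
    refine tendsto_const_nhds.congr fun n => ?_
    exact ((hF n a).2.2.2 i).symm
  have hlimM : ∀ a : Σ _ : ℕ, ℕ × ℕ, Tendsto (fun n : SymMeasure c =>
      toEllOne (quotientMatrix n.1 (F n a))) l
      (𝓝 (toEllOne (quotientMatrixOn μ' fun (i : Fin (a.1 + 1)) z => (z a).1 i))) := fun a => by
    refine ((toEllOne_continuous _).tendsto _).comp ?_
    refine tendsto_pi_nhds.2 fun i => tendsto_pi_nhds.2 fun j => ?_
    exact hlim2 (fun z => (z.1 a).1 i * (z.2 a).1 j)
      (((continuous_coordinate a i).comp continuous_fst).mul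
        ((continuous_coordinate a j).comp continuous_snd))
  have key := fun ε (hε : 0 < ε) => eventually_hausdorffDist_le (l := (l : Filter (SymMeasure c)))
    (S := fun n => toEllOne '' shape n.1 (k + 1)) (T := toEllOne '' shape μ.1 (k + 1))
    (isCompact_closedBall 0 (max c 0)).totallyBounded
    (fun n => shape_subset_closedBall n _) (shape_subset_closedBall μ _)
    ((shape_nonempty _ _).image _) (hq k)
    ?_ ?_ (ε := ε) hε
  · rw [Metric.tendsto_nhds]
    intro ε hε
    filter_upwards [key (ε / 2) (half_pos hε)] with n hn
    rw [Real.dist_0_eq_abs, abs_of_nonneg (matrixHausdorffDist_nonneg _ _)]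
    exact lt_of_le_of_lt hn (half_lt_self hε)
  · intro y hy ε hε
    obtain ⟨_, ⟨_, hf, rfl⟩, hyf⟩ :=
      Metric.mem_closure_iff.1 (image_shape_subset μ.1 _ hy) (ε / 2) (half_pos hε)
    rw [hμ] at hf
    obtain ⟨f, hf, rfl⟩ := hf
    have hev := eventually_exists_quotientMatrix_close (l := (l : Filter (SymMeasure c))) hc hφ
      hlim1 hlim2 (fun _ => by positivity) hf
      (ε := ε / (2 * ((k + 1 : ℕ) : ℝ) ^ 2)) (by positivity)
    filter_upwards [hev] with n ⟨f', hf', hclose⟩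
    refine ⟨_, ⟨_, subset_closure ⟨f', hf', rfl⟩, rfl⟩, ?_⟩
    have h1 := dist_toEllOne_le hclose
    have h2 : ((k + 1 : ℕ) : ℝ) ^ 2 * (ε / (2 * ((k + 1 : ℕ) : ℝ) ^ 2)) = ε / 2 := by
      field_simp
    rw [h2, dist_comm] at h1
    have := dist_triangle y (toEllOne (quotientMatrixOn μ' f)) (toEllOne (quotientMatrix n.1 f'))
    linarith
  · intro m ε hε
    obtain ⟨j, hj⟩ := exists_nat_one_div_lt (half_pos hε)
    set a : Σ _ : ℕ, ℕ × ℕ := ⟨k, m, j⟩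
    have hmem : toEllOne (quotientMatrixOn μ' fun (i : Fin (a.1 + 1)) z => (z a).1 i) ∈
        toEllOne '' shape μ.1 (k + 1) := by
      refine ⟨_, subset_closure ?_, rfl⟩
      rw [hμ]
      exact ⟨_, hcoord a, rfl⟩
    filter_upwards [Metric.tendsto_nhds.1 (hlimM a) (ε / 2) (half_pos hε)] with n hn
    have h1 := Metric.infDist_le_dist_of_mem (x := q k m) hmem
    have h2 : dist (q k m) (toEllOne (quotientMatrix n.1 (F n a))) ≤
        Metric.infDist (q k m) (toEllOne '' shape n.1 (k + 1)) + 1 / ((j : ℝ) + 1) := hFd n a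
    have h3 := dist_triangle (q k m) (toEllOne (quotientMatrix n.1 (F n a)))
      (toEllOne (quotientMatrixOn μ' fun (i : Fin (a.1 + 1)) z => (z a).1 i))
    linarith

/-! ### Transferring quotient matrices between nearby measures -/

/-- Merging the members of a fractional partition along `s : Fin N → Fin k`. -/
noncomputable def mergeParts {X : Type*} {N k : ℕ} (s : Fin N → Fin k) (g : Fin N → X → ℝ) :
    Fin k → X → ℝ :=
  fun i x => ∑ j with s j = i, g j x

section Merge

variable {X : Type*} [MeasurableSpace X] {N k : ℕ} {s : Fin N → Fin k} {g : Fin N → X → ℝ}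

lemma IsFracPartition.mergeParts (hg : IsFracPartition g) (s : Fin N → Fin k) :
    IsFracPartition (mergeParts s g) :=
  ⟨fun _ => Finset.measurable_fun_sum _ fun j _ => hg.measurable j,
    fun _ x => Finset.sum_nonneg fun j _ => hg.nonneg j x,
    fun x => (Finset.sum_fiberwise _ s fun j => g j x).trans (hg.sum_eq x)⟩

lemma quotientMatrixOn_mergeParts (hg : IsFracPartition g) (s : Fin N → Fin k)
    (μ : Measure (X × X)) [IsFiniteMeasure μ] (i i' : Fin k) :
    quotientMatrixOn μ (mergeParts s g) i i' =
      ∑ j with s j = i, ∑ j' with s j' = i', quotientMatrixOn μ g j j' := by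
  simp only [quotientMatrixOn, Matrix.of_apply, mergeParts, Finset.sum_mul_sum]
  rw [integral_finsetSum _ fun j _ => integrable_finsetSum _ fun j' _ => hg.integrable_mul μ j j']
  exact Finset.sum_congr rfl fun j _ => integral_finsetSum _ fun j' _ => hg.integrable_mul μ j j'

end Merge

lemma exists_fiber_card {k : ℕ} (a : Fin k → ℕ) {N : ℕ} (h : ∑ i, a i = N) :
    ∃ s : Fin N → Fin k, ∀ i, (Finset.univ.filter fun j => s j = i).card = a i := by
  classical
  subst h
  refine ⟨fun j => (finSigmaFinEquiv.symm j).1, fun i => ?_⟩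
  rw [← Fintype.card_subtype]
  have e : {j : Fin (∑ i, a i) // (finSigmaFinEquiv.symm j).1 = i} ≃ Fin (a i) :=
    (finSigmaFinEquiv.symm.subtypeEquiv fun j => Iff.rfl).trans
      (Equiv.sigmaSubtype i)
  rw [Fintype.card_congr e, Fintype.card_fin]

/-- If the `N`-shapes of two measures are close, then so are their quotient matrices for vectors
of integrals in `ℕ / N`: split every function into equal parts, replace the resulting partition
into functions of integral `1 / N`, and merge again. -/
lemma exists_close_of_rational {c : ℝ} (μ₁ μ₂ : SymMeasure c) {N : ℕ} (hN : 0 < N) {δ : ℝ}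
    (hδ : matrixHausdorffDist (shape μ₁.1 N) (shape μ₂.1 N) < δ) {k : ℕ} {a : Fin k → ℕ}
    (ha : ∀ i, 0 < a i) (haN : ∑ i, a i = N) {f : Fin k → Cantor → ℝ}
    (hf : f ∈ fracPartitions fun i => (a i : ℝ) / N) :
    ∃ f' ∈ fracPartitions (fun i => (a i : ℝ) / N),
      ∀ i j, |quotientMatrix μ₁.1 f i j - quotientMatrix μ₂.1 f' i j| ≤ δ := by
  obtain ⟨s, hs⟩ := exists_fiber_card a haN
  have hN' : (N : ℝ) ≠ 0 := by exact_mod_cast hN.ne'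
  have ha' : ∀ i, (a i : ℝ) ≠ 0 := fun i => by exact_mod_cast (ha i).ne'
  rw [fracPartitions_eq] at hf
  -- `f_i` is split into `a_i` equal parts, indexed by the fiber of `s` over `i`
  set g : Fin N → Cantor → ℝ := fun j x => f (s j) x / a (s j) with hg
  have hgf : mergeParts s g = f := by
    funext i x
    have : ∀ j ∈ Finset.univ.filter fun j => s j = i, g j x = f i x / a i := fun j hj => by
      simp only [hg, (Finset.mem_filter.1 hj).2]
    rw [mergeParts, Finset.sum_congr rfl this, Finset.sum_const, hs, nsmul_eq_mul,
      mul_div_cancel₀ _ (ha' i)]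
  have hgp : IsFracPartition g := by
    refine ⟨fun j => (hf.1.measurable _).div_const _,
      fun j x => div_nonneg (hf.1.nonneg _ x) (Nat.cast_nonneg _), fun x => ?_⟩
    rw [← hf.1.sum_eq x, ← Finset.sum_fiberwise _ s fun j => g j x]
    exact Finset.sum_congr rfl fun i _ => congrFun (congrFun hgf i) x
  have hgmem : g ∈ fracPartitions fun _ : Fin N => 1 / (N : ℝ) := by
    refine mem_fracPartitions_iff.2 ⟨hgp, fun j => ?_⟩
    have := ha' (s j)
    simp only [hg]
    rw [integral_div, hf.2]
    field_simp
  have hmem : toEllOne (quotientMatrix μ₁.1 g) ∈ toEllOne '' shape μ₁.1 N :=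
    ⟨_, subset_closure ⟨g, hgmem, rfl⟩, rfl⟩
  obtain ⟨n, rfl⟩ := Nat.exists_eq_succ_of_ne_zero hN.ne'
  obtain ⟨y, hy, hyd⟩ := Metric.exists_dist_lt_of_hausdorffDist_lt hmem hδ
    (shape_hausdorffEDist_ne_top μ₁ μ₂ n)
  obtain ⟨_, ⟨_, ⟨g', hg', rfl⟩, rfl⟩, hyg⟩ :=
    Metric.mem_closure_iff.1 (image_shape_subset μ₂.1 _ hy) _ (sub_pos.2 hyd)
  have hd : dist (toEllOne (quotientMatrix μ₁.1 g)) (toEllOne (quotientMatrix μ₂.1 g')) ≤ δ := by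
    have := dist_triangle (toEllOne (quotientMatrix μ₁.1 g)) y
      (toEllOne (quotientMatrix μ₂.1 g'))
    linarith
  rw [fracPartitions_eq] at hg'
  refine ⟨mergeParts s g', mem_fracPartitions_iff.2 ⟨hg'.1.mergeParts s, fun i => ?_⟩,
    fun i i' => ?_⟩
  · simp only [mergeParts]
    rw [integral_finsetSum _ fun j _ => hg'.1.integrable _ j]
    simp only [hg'.2]
    rw [Finset.sum_const, hs, nsmul_eq_mul, mul_one_div]
  · rw [← hgf, quotientMatrix_eq, quotientMatrix_eq, quotientMatrixOn_mergeParts hgp,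
      quotientMatrixOn_mergeParts hg'.1]
    simp only [← Finset.sum_sub_distrib]
    refine le_trans ?_ hd
    rw [dist_toEllOne]
    refine (Finset.abs_sum_le_sum_abs _ _).trans ?_
    refine (Finset.sum_le_sum fun j _ => (Finset.abs_sum_le_sum_abs _ _).trans
      (Finset.sum_le_univ_sum_of_nonneg fun j' => abs_nonneg _)).trans ?_
    exact Finset.sum_le_univ_sum_of_nonneg fun j => Finset.sum_nonneg fun j' _ => abs_nonneg _

/-- Rounding a probability vector to multiples of `1 / N`. -/
lemma exists_rational_weights {k N : ℕ} {α : Fin k → ℝ} {ε η : ℝ}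
    (hη : ∀ i, η ≤ α i) (hα : ∑ i, α i = 1) (hε0 : 0 < ε) (hη0 : 0 < η) (hε1 : ε ≤ 1)
    (hN : k + 2 ≤ ε * N * η) :
    ∃ a : Fin k → ℕ, ∑ i, a i = N ∧ ∀ i, 0 < a i ∧ N * α i ≤ (1 + ε) * a i ∧
      a i ≤ (1 + ε) * (N * α i) := by
  have hα0 : ∀ i, 0 < α i := fun i => hη0.trans_le (hη i)
  rcases isEmpty_or_nonempty (Fin k) with h | ⟨⟨i₀⟩⟩
  · simp at hα
  set b : Fin k → ℕ := fun i => ⌊N * α i⌋₊ with hb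
  have hb1 : ∀ i, (b i : ℝ) ≤ N * α i := fun i => Nat.floor_le (by have := hα0 i; positivity)
  have hb2 : ∀ i, N * α i - 1 ≤ b i := fun i => (Nat.sub_one_lt_floor _).le
  have hs1 : ∑ i, b i ≤ N := by
    have : (∑ i, b i : ℝ) ≤ ∑ i, N * α i := Finset.sum_le_sum fun i _ => hb1 i
    rw [← Finset.mul_sum, hα, mul_one] at this
    exact_mod_cast this
  have hs2 : (N : ℝ) - k ≤ ∑ i, (b i : ℝ) := by
    have : ∑ i, (N * α i - 1) ≤ ∑ i, (b i : ℝ) := Finset.sum_le_sum fun i _ => hb2 i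
    rw [Finset.sum_sub_distrib, ← Finset.mul_sum, hα] at this
    simpa using this
  -- the remainder, at most `k`, is given to one index
  set r : ℕ := N - ∑ i, b i with hr
  have hrk : (r : ℝ) ≤ k := by
    rw [hr, Nat.cast_sub hs1]; push_cast; linarith
  refine ⟨fun i => b i + if i = i₀ then r else 0, ?_, fun i => ?_⟩
  · rw [Finset.sum_add_distrib]; simp [hr, hs1]
  · have hkey : (k : ℝ) + 2 ≤ ε * (N * α i) := by
      have : ε * N * η ≤ ε * N * α i := mul_le_mul_of_nonneg_left (hη i) (by positivity)
      linarith
    have h1 : (0 : ℝ) ≤ (if i = i₀ then r else 0 : ℕ) := Nat.cast_nonneg _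
    have h2 : ((if i = i₀ then r else 0 : ℕ) : ℝ) ≤ k := by
      split_ifs
      · exact hrk
      · simp
    have h3 := hb1 i
    have h4 := hb2 i
    have hk0 : (0 : ℝ) ≤ k := k.cast_nonneg
    have hNα : 0 ≤ N * α i := by have := hα0 i; positivity
    refine ⟨?_, ?_, ?_⟩
    · have : (0 : ℝ) < b i := by nlinarith
      exact Nat.add_pos_left (by exact_mod_cast this) _
    · push_cast at h1 ⊢
      nlinarith
    · push_cast at h2 ⊢
      nlinarith

/-- Measures that are close in the shape metric have entrywise close quotient matrices, for all
vectors of integrals that are bounded below by `η`, with uniform bounds. -/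
lemma exists_pos_forall_exists_close {c η ε : ℝ} (hc : 0 ≤ c) (hη : 0 < η) (hε : 0 < ε) :
    ∃ r > 0, ∀ μ₁ μ₂ : SymMeasure c, dist μ₁ μ₂ < r → ∀ (k : ℕ) (α : Fin k → ℝ),
      (∀ i, η ≤ α i) → ∑ i, α i = 1 → ∀ f ∈ fracPartitions α, ∃ f' ∈ fracPartitions α,
        ∀ i j, |quotientMatrix μ₁.1 f i j - quotientMatrix μ₂.1 f' i j| ≤ ε := by
  obtain ⟨δ, hδ0, hδ1, hδ⟩ := exists_correction_size hc hε
  -- `k ≤ 1 / η` for all admissible `α`, so this `N` serves for the rounding of every `α`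
  obtain ⟨N, hN⟩ := exists_nat_ge ((1 / η + 2) / (δ * η))
  rw [div_le_iff₀ (by positivity)] at hN
  have hN0 : 0 < N := by
    rcases Nat.eq_zero_or_pos N with rfl | h
    · have : 0 < 1 / η := by positivity
      simp at hN; linarith [this, one_div η]
    · exact h
  refine ⟨(1 / 2) ^ N * (ε / 3), by positivity, fun μ₁ μ₂ hd k α hαη hα f hf => ?_⟩
  have hD : matrixHausdorffDist (shape μ₁.1 N) (shape μ₂.1 N) < ε / 3 := by
    obtain ⟨n, rfl⟩ := Nat.exists_eq_succ_of_ne_zero hN0.ne'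
    have h1 : (1 / 2 : ℝ) ^ (n + 1) * matrixHausdorffDist (shape μ₁.1 (n + 1))
        (shape μ₂.1 (n + 1)) ≤ dist μ₁ μ₂ :=
      (shapeDist_summable μ₁ μ₂).le_tsum n fun j _ =>
        mul_nonneg (by positivity) (matrixHausdorffDist_nonneg _ _)
    exact lt_of_mul_lt_mul_left (h1.trans_lt hd) (by positivity)
  have hk : (k : ℝ) ≤ 1 / η := by
    have : ∑ _i : Fin k, η ≤ ∑ i, α i := Finset.sum_le_sum fun i _ => hαη i
    rw [hα, Finset.sum_const, Finset.card_univ, Fintype.card_fin, nsmul_eq_mul] at this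
    rwa [le_div_iff₀ hη]
  obtain ⟨a, haN, ha⟩ := exists_rational_weights (N := N) hαη hα hδ0 hη hδ1 (by linarith)
  have hNR : (0 : ℝ) < N := by exact_mod_cast hN0
  rw [fracPartitions_eq] at hf ⊢
  obtain ⟨g, hg, hgf⟩ := hf.1.exists_mem_fracPartitionsOn cantorMeasure
    (α := fun i => (a i : ℝ) / N)
    (by rw [← Finset.sum_div, ← Nat.cast_sum, haN, div_self hNR.ne']) hδ0.le hδ1 fun i => by
      rw [hf.2, ← mul_div_assoc, le_div_iff₀ hNR]
      linarith [(ha i).2.1]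
  obtain ⟨g', hg', hgg'⟩ := exists_close_of_rational μ₁ μ₂ hN0 hD (fun i => (ha i).1) haN
    (mem_fracPartitions_iff.2 hg)
  rw [fracPartitions_eq] at hg'
  obtain ⟨f', hf', hfg'⟩ := hg'.1.exists_mem_fracPartitionsOn cantorMeasure hα hδ0.le hδ1
    fun i => by
      rw [hg'.2, div_le_iff₀ hNR]
      linarith [(ha i).2.2]
  -- the three errors come from rounding `α`, from the shapes, and from returning to `α`
  refine ⟨f', hf', fun i j => ?_⟩
  have hmass : ∀ μ : SymMeasure c, 2 * δ * μ.1.real univ ≤ ε / 3 := fun μ =>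
    (mul_le_mul_of_nonneg_left (μ.real_univ_le hc) (by positivity)).trans hδ
  have e1 := (hg.1.abs_quotientMatrixOn_sub_le_of_forall hf.1 μ₁.1 hgf i j).trans (hmass μ₁)
  have e2 := hgg' i j
  have e3 := (hf'.1.abs_quotientMatrixOn_sub_le_of_forall hg'.1 μ₂.1 hfg' i j).trans (hmass μ₂)
  simp only [quotientMatrix_eq] at e2 ⊢
  rw [abs_le] at *
  constructor <;> linarith [e1.1, e1.2, e2.1, e2.2, e3.1, e3.2]

/-! ### The weighted norm, and openness and closedness of upper regularity -/

/-- The weighted norm as an unweighted `ℓᵖ` norm. -/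
lemma weightedNorm_eq {k : ℕ} {α : Fin k → ℝ} (hα : ∀ i, 0 < α i) {p : ℝ} (hp : 1 ≤ p)
    (M : Matrix (Fin k) (Fin k) ℝ) :
    weightedNorm α p M = (∑ q : Fin k × Fin k,
      |M q.1 q.2 / (α q.1 * α q.2) * (α q.1 * α q.2) ^ (1 / p)| ^ p) ^ (1 / p) := by
  rw [weightedNorm, Fintype.sum_prod_type]
  congr 1
  refine Finset.sum_congr rfl fun i _ => Finset.sum_congr rfl fun j _ => ?_
  have h : 0 < α i * α j := mul_pos (hα i) (hα j)
  rw [abs_mul, abs_of_nonneg (Real.rpow_nonneg h.le _), Real.mul_rpow (abs_nonneg _)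
    (Real.rpow_nonneg h.le _), ← Real.rpow_mul h.le, one_div_mul_cancel (by linarith),
    Real.rpow_one]

lemma weightedNorm_add_le {k : ℕ} {α : Fin k → ℝ} (hα : ∀ i, 0 < α i) {p : ℝ} (hp : 1 ≤ p)
    (M M' : Matrix (Fin k) (Fin k) ℝ) :
    weightedNorm α p (M + M') ≤ weightedNorm α p M + weightedNorm α p M' := by
  rw [weightedNorm_eq hα hp, weightedNorm_eq hα hp, weightedNorm_eq hα hp]
  refine le_trans (le_of_eq ?_) (Real.Lp_add_le _ _ _ hp)
  congr 1
  refine Finset.sum_congr rfl fun q _ => ?_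
  rw [Matrix.add_apply, add_div, add_mul]

/-- The weights `α_i α_j` form a probability vector, so the norm is at most the maximum. -/
lemma weightedNorm_le {k : ℕ} {α : Fin k → ℝ} {η : ℝ} (hη : 0 < η) (hα : ∀ i, η ≤ α i)
    (hα1 : ∑ i, α i = 1) {p : ℝ} (hp : 1 ≤ p) {M : Matrix (Fin k) (Fin k) ℝ} {ε : ℝ} (hε : 0 ≤ ε)
    (hM : ∀ i j, |M i j| ≤ ε * η ^ 2) : weightedNorm α p M ≤ ε := by
  have hα0 : ∀ i, 0 < α i := fun i => hη.trans_le (hα i)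
  have h : ∑ i, ∑ j, |M i j / (α i * α j)| ^ p * (α i * α j) ≤ ε ^ p := by
    calc _ ≤ ∑ i, ∑ j, ε ^ p * (α i * α j) := by
          refine Finset.sum_le_sum fun i _ => Finset.sum_le_sum fun j _ => ?_
          have h0 : 0 < α i * α j := mul_pos (hα0 i) (hα0 j)
          refine mul_le_mul_of_nonneg_right
            (Real.rpow_le_rpow (abs_nonneg _) ?_ (by linarith)) h0.le
          rw [abs_div, abs_of_pos h0, div_le_iff₀ h0]
          refine (hM i j).trans (mul_le_mul_of_nonneg_left ?_ hε)
          rw [sq]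
          exact mul_le_mul (hα i) (hα j) hη.le (hα0 i).le
      _ = ε ^ p := by
          simp only [← Finset.mul_sum, hα1, mul_one]
  calc weightedNorm α p M ≤ (ε ^ p) ^ (1 / p) := Real.rpow_le_rpow
        (Finset.sum_nonneg fun i _ => Finset.sum_nonneg fun j _ => mul_nonneg
          (Real.rpow_nonneg (abs_nonneg _) _) (mul_pos (hα0 i) (hα0 j)).le) h (by positivity)
    _ = ε := by rw [← Real.rpow_mul hε, mul_one_div_cancel (by linarith), Real.rpow_one]

lemma weightedNorm_smul {k : ℕ} {α : Fin k → ℝ} (hα : ∀ i, 0 ≤ α i) {p : ℝ} (hp : 1 ≤ p)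
    {t : ℝ} (ht : 0 ≤ t) (M : Matrix (Fin k) (Fin k) ℝ) :
    weightedNorm α p (t • M) = t * weightedNorm α p M := by
  have h : ∀ i j, |(t • M) i j / (α i * α j)| ^ p * (α i * α j) =
      t ^ p * (|M i j / (α i * α j)| ^ p * (α i * α j)) := fun i j => by
    rw [Matrix.smul_apply, smul_eq_mul, mul_div_assoc, abs_mul, abs_of_nonneg ht,
      Real.mul_rpow ht (abs_nonneg _), mul_assoc]
  simp only [weightedNorm, h, ← Finset.mul_sum]
  rw [Real.mul_rpow (Real.rpow_nonneg ht _) (Finset.sum_nonneg fun i _ => Finset.sum_nonneg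
    fun j _ => mul_nonneg (Real.rpow_nonneg (abs_nonneg _) _) (mul_nonneg (hα i) (hα j))),
    ← Real.rpow_mul ht, mul_one_div_cancel (by linarith), Real.rpow_one]

variable {c C p η : ℝ}

/-- Upper regularity with a larger constant is inherited within a fixed distance. -/
lemma exists_pos_forall_mem_shapeRegular {C' : ℝ} (hc : 0 ≤ c) (hp : 1 ≤ p) (hη : 0 < η)
    (hC : C < C') :
    ∃ r > 0, ∀ μ₁ μ₂ : SymMeasure c, dist μ₁ μ₂ < r → μ₂ ∈ shapeRegular c C p η →
      μ₁ ∈ shapeRegular c C' p η := by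
  obtain ⟨r, hr, h⟩ := exists_pos_forall_exists_close (c := c) (η := η)
    (ε := (C' - C) * η ^ 2) hc hη (mul_pos (sub_pos.2 hC) (by positivity))
  refine ⟨r, hr, fun μ₁ μ₂ hd hμ k hk α hα hα1 f hf => ?_⟩
  obtain ⟨f', hf', hclose⟩ := h μ₁ μ₂ hd k α (fun i => (hα i).1) hα1 f hf
  have h1 := weightedNorm_add_le (fun i => hη.trans_le (hα i).1) hp (quotientMatrix μ₂.1 f')
    (quotientMatrix μ₁.1 f - quotientMatrix μ₂.1 f')
  have h2 := weightedNorm_le hη (fun i => (hα i).1) hα1 hp (sub_nonneg.2 hC.le) hclose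
  have h3 := hμ k hk α hα hα1 f' hf'
  rw [add_sub_cancel] at h1
  change weightedNorm α p (quotientMatrix μ₁.1 f - quotientMatrix μ₂.1 f') ≤ _ at h2
  linarith

lemma isClosed_shapeRegular (hc : 0 ≤ c) (hp : 1 ≤ p) (hη : 0 < η) :
    IsClosed (shapeRegular c C p η) := by
  refine isClosed_of_closure_subset fun μ hμ k hk α hα hα1 f hf => ?_
  refine le_of_forall_gt_imp_ge_of_dense fun C' hC' => ?_
  obtain ⟨r, hr, h⟩ := exists_pos_forall_mem_shapeRegular (C := C) (C' := C') hc hp hη hC'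
  obtain ⟨μ', hμ', hd⟩ := Metric.mem_closure_iff.1 hμ r hr
  exact h μ μ' hd hμ' k hk α hα hα1 f hf

lemma isCompact_shapeRegular (hc : 0 ≤ c) (hp : 1 ≤ p) (hη : 0 < η) :
    IsCompact (shapeRegular c C p η) :=
  (isCompact_univ_symMeasure hc).of_isClosed_subset (isClosed_shapeRegular hc hp hη)
    (subset_univ _)

lemma shapeRegular_subset_interior {C' : ℝ} (hc : 0 ≤ c) (hp : 1 ≤ p) (hη : 0 < η)
    (hC : C < C') : shapeRegular c C p η ⊆ interior (shapeRegular c C' p η) := fun μ hμ => by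
  obtain ⟨r, hr, h⟩ := exists_pos_forall_mem_shapeRegular (C := C) (C' := C') hc hp hη hC
  rw [mem_interior_iff_mem_nhds]
  exact Filter.mem_of_superset (Metric.ball_mem_nhds μ hr) fun μ' hμ' => h μ' μ hμ' hμ

/-! ### Interior points -/

/-- Adding a measure `σ` moves a point of `𝓜⁺_c` by at most the total mass of `σ`. -/
lemma dist_le_of_eq_add (μ₁ μ₂ : SymMeasure c) (σ : Measure (Cantor × Cantor)) [IsFiniteMeasure σ]
    (h : μ₂.1 = μ₁.1 + σ) : dist μ₁ μ₂ ≤ σ.real univ := by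
  have hM : ∀ (k : ℕ) (α : Fin k → ℝ), ∀ f ∈ fracPartitions α,
      dist (toEllOne (quotientMatrix μ₁.1 f)) (toEllOne (quotientMatrix μ₂.1 f)) ≤
        σ.real univ := fun k α f hf => by
    rw [fracPartitions_eq] at hf
    rw [dist_toEllOne, ← hf.1.sum_quotientMatrixOn σ]
    refine Finset.sum_le_sum fun i _ => Finset.sum_le_sum fun j _ => ?_
    have : quotientMatrix μ₂.1 f i j = quotientMatrix μ₁.1 f i j + quotientMatrixOn σ f i j := by
      simp only [quotientMatrix, quotientMatrixOn, Matrix.of_apply]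
      rw [h, integral_add_measure (hf.1.integrable_mul μ₁.1 i j) (hf.1.integrable_mul σ i j)]
    rw [this, sub_add_cancel_left, abs_neg, abs_of_nonneg (hf.1.quotientMatrixOn_nonneg σ i j)]
  have hD : ∀ k, matrixHausdorffDist (shape μ₁.1 k) (shape μ₂.1 k) ≤ σ.real univ := fun k => by
    refine le_of_forall_pos_le_add fun δ hδ => ?_
    refine Metric.hausdorffDist_le_of_mem_dist (by positivity) (fun x hx => ?_) fun x hx => ?_
    · obtain ⟨_, ⟨_, ⟨f, hf, rfl⟩, rfl⟩, hxf⟩ :=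
        Metric.mem_closure_iff.1 (image_shape_subset _ _ hx) δ hδ
      refine ⟨_, ⟨_, subset_closure ⟨f, hf, rfl⟩, rfl⟩, ?_⟩
      have := dist_triangle x (toEllOne (quotientMatrix μ₁.1 f)) (toEllOne (quotientMatrix μ₂.1 f))
      linarith [hM k _ f hf]
    · obtain ⟨_, ⟨_, ⟨f, hf, rfl⟩, rfl⟩, hxf⟩ :=
        Metric.mem_closure_iff.1 (image_shape_subset _ _ hx) δ hδ
      refine ⟨_, ⟨_, subset_closure ⟨f, hf, rfl⟩, rfl⟩, ?_⟩
      have := dist_triangle_right x (toEllOne (quotientMatrix μ₁.1 f))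
        (toEllOne (quotientMatrix μ₂.1 f))
      linarith [hM k _ f hf]
  have hg : HasSum (fun k : ℕ => (1 / 2 : ℝ) ^ (k + 1) * σ.real univ) (σ.real univ) := by
    have := (hasSum_geometric_two' (1 : ℝ)).mul_right (σ.real univ)
    rw [one_mul] at this
    convert! this using 3 with k
    rw [pow_succ', div_pow, one_pow, div_div, one_div_mul_one_div]
  calc dist μ₁ μ₂ ≤ ∑' k : ℕ, (1 / 2 : ℝ) ^ (k + 1) * σ.real univ :=
        (shapeDist_summable μ₁ μ₂).tsum_le_tsum
          (fun k => mul_le_mul_of_nonneg_left (hD (k + 1)) (by positivity)) hg.summable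
    _ = σ.real univ := hg.tsum_eq

/-- The total mass is a quotient matrix, for the partition into one function. -/
lemma real_univ_le_of_mem_shapeRegular (hp : 1 ≤ p) (hη1 : η ≤ 1) {μ : SymMeasure c}
    (hμ : μ ∈ shapeRegular c C p η) : μ.1.real univ ≤ C := by
  have h := hμ 1 one_pos (fun _ => 1) (fun _ => ⟨hη1, le_rfl⟩) (by simp) (fun _ _ => 1)
    ⟨fun _ => measurable_const, fun _ _ => zero_le_one, fun _ => by simp, fun _ => by simp⟩
  have e : weightedNorm (fun _ : Fin 1 => (1 : ℝ)) p (quotientMatrix μ.1 fun _ _ => 1) =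
      μ.1.real univ := by
    simp only [weightedNorm, quotientMatrix, Finset.univ_unique, Finset.sum_singleton,
      Matrix.of_apply, mul_one, div_one, integral_const, smul_eq_mul]
    rw [abs_of_nonneg measureReal_nonneg, ← Real.rpow_mul measureReal_nonneg,
      mul_one_div_cancel (by linarith), Real.rpow_one]
  rwa [e] at h

lemma exists_symMeasure_add (μ : SymMeasure c) {σ : Measure (Cantor × Cantor)}
    [IsFiniteMeasure σ] (hσ : σ.map Prod.swap = σ) (h : μ.1.real univ + σ.real univ ≤ c) :
    ∃ μ' : SymMeasure c, μ'.1 = μ.1 + σ := by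
  refine ⟨⟨μ.1 + σ, ?_, ?_⟩, rfl⟩
  · rw [Measure.map_add _ _ measurable_swap, μ.2.1, hσ]
  · rw [← ofReal_measureReal (measure_ne_top _ _)]
    refine ENNReal.ofReal_le_ofReal ?_
    rwa [measureReal_add_apply]

/-- An interior point of mass less than `c` is not extremal: `(1 + t) μ` is still upper regular
for small `t > 0`, which improves the constant of `μ` by the factor `1 + t`. -/
lemma mem_iUnion_of_mem_interior (hc : 0 < c) (hC : 0 ≤ C) (hp : 1 ≤ p) (hη : 0 < η)
    (hη1 : η ≤ 1) {μ : SymMeasure c} (hμ : μ ∈ interior (shapeRegular c C p η))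
    (hμc : μ.1.real univ < c) : μ ∈ ⋃ ε ∈ Ioo 0 C, shapeRegular c (C - ε) p η := by
  rw [mem_interior_iff_mem_nhds, Metric.mem_nhds_iff] at hμ
  obtain ⟨r, hr, hball⟩ := hμ
  have hstep : ∀ σ : Measure (Cantor × Cantor), ∀ _ : IsFiniteMeasure σ, σ.map Prod.swap = σ →
      μ.1.real univ + σ.real univ ≤ c → σ.real univ < r →
      ∃ μ' ∈ shapeRegular c C p η, μ'.1 = μ.1 + σ := fun σ _ hσ h1 h2 => by
    obtain ⟨μ', hμ'⟩ := exists_symMeasure_add μ hσ h1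
    refine ⟨μ', hball ?_, hμ'⟩
    rw [Metric.mem_ball, dist_comm]
    exact (dist_le_of_eq_add μ μ' σ hμ').trans_lt h2
  rcases hC.eq_or_lt with rfl | hC0
  · -- for `C = 0` there are no interior points of mass less than `c`: add a multiple of `ν × ν`
    exfalso
    set t := min (c - μ.1.real univ) (r / 2)
    have ht : 0 < t := lt_min (sub_pos.2 hμc) (half_pos hr)
    have ht1 : t ≤ c - μ.1.real univ := min_le_left _ _
    have ht2 : t ≤ r / 2 := min_le_right _ _
    have hreal : ((ENNReal.ofReal t) • cantorMeasure.prod cantorMeasure).real univ = t := by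
      rw [measureReal_ennreal_smul_apply, probReal_univ, mul_one, ENNReal.toReal_ofReal ht.le]
    have hfin : IsFiniteMeasure ((ENNReal.ofReal t) • cantorMeasure.prod cantorMeasure) :=
      Measure.smul_finite _ ENNReal.ofReal_ne_top
    obtain ⟨μ', hμ', he⟩ := hstep ((ENNReal.ofReal t) • cantorMeasure.prod cantorMeasure) hfin
      (by rw [Measure.map_smul, Measure.prod_swap]) (by rw [hreal]; linarith)
      (by rw [hreal]; linarith)
    have h := real_univ_le_of_mem_shapeRegular hp hη1 hμ'
    rw [he, measureReal_add_apply, hreal] at h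
    linarith [measureReal_nonneg (μ := μ.1) (s := univ)]
  · set t := min ((c - μ.1.real univ) / c) (r / (2 * c))
    have ht : 0 < t := lt_min (div_pos (sub_pos.2 hμc) hc) (by positivity)
    have ht1 : t * c ≤ c - μ.1.real univ := (le_div_iff₀ hc).1 (min_le_left _ _)
    have ht2 : t * (2 * c) ≤ r := (le_div_iff₀ (by positivity)).1 (min_le_right _ _)
    have hreal : ((ENNReal.ofReal t) • μ.1).real univ = t * μ.1.real univ := by
      rw [measureReal_ennreal_smul_apply, ENNReal.toReal_ofReal ht.le]
    have hle : t * μ.1.real univ ≤ t * c := mul_le_mul_of_nonneg_left hμc.le ht.le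
    have htc : 0 < t * c := mul_pos ht hc
    obtain ⟨μ', hμ', he⟩ := hstep ((ENNReal.ofReal t) • μ.1)
      (Measure.smul_finite _ ENNReal.ofReal_ne_top)
      (by rw [Measure.map_smul, μ.2.1]) (by rw [hreal]; linarith) (by rw [hreal]; linarith)
    have hε : C - C * t / (1 + t) = C / (1 + t) := by field_simp; ring
    refine mem_iUnion₂.2 ⟨C * t / (1 + t), ⟨by positivity, ?_⟩, ?_⟩
    · rw [div_lt_iff₀ (by positivity)]; nlinarith
    · rw [hε]
      intro k hk α hα hα1 f hf
      have h := hμ' k hk α hα hα1 f hf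
      have hM : quotientMatrix μ'.1 f = (1 + t) • quotientMatrix μ.1 f := by
        rw [fracPartitions_eq] at hf
        ext i j
        simp only [quotientMatrix, Matrix.of_apply, Matrix.smul_apply, smul_eq_mul]
        rw [he, integral_add_measure (hf.1.integrable_mul μ.1 i j)
          ((hf.1.integrable_mul μ.1 i j).smul_measure ENNReal.ofReal_ne_top),
          integral_smul_measure, ENNReal.toReal_ofReal ht.le, smul_eq_mul]
        ring
      rw [hM, weightedNorm_smul (fun i => hη.le.trans (hα i).1) hp (by positivity)] at h
      rwa [le_div_iff₀ (by positivity), mul_comm]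

/-! ### Measures with a density in `Lᵖ` are upper regular -/

lemma weightedNorm_withDensity_le {k : ℕ} {α : Fin k → ℝ} (hα : ∀ i, 0 < α i) {p C : ℝ}
    (hp : 1 < p) (hC : 0 ≤ C) {f : Fin k → Cantor → ℝ} (hf : f ∈ fracPartitions α)
    {h : Cantor × Cantor → ℝ} (h0 : ∀ z, 0 ≤ h z)
    (hm : MemLp h (ENNReal.ofReal p) (cantorMeasure.prod cantorMeasure))
    (hn : eLpNorm h (ENNReal.ofReal p) (cantorMeasure.prod cantorMeasure) ≤ ENNReal.ofReal C)
    {μ : Measure (Cantor × Cantor)}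
    (hμ : μ = (cantorMeasure.prod cantorMeasure).withDensity fun z => ENNReal.ofReal (h z)) :
    weightedNorm α p (quotientMatrix μ f) ≤ C := by
  rw [fracPartitions_eq] at hf
  set π := cantorMeasure.prod cantorMeasure with hπ
  have hp0 : 0 < p := one_pos.trans hp
  have hpq := Real.HolderConjugate.conjExponent hp
  set q := p.conjExponent
  have hq0 : 0 < q := hpq.symm.pos
  have hpe : ENNReal.ofReal p ≠ 0 := by simpa using hp0
  have hpint : Integrable (fun z => h z ^ p) π := by
    have := hm.integrable_norm_rpow hpe ENNReal.ofReal_ne_top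
    rw [ENNReal.toReal_ofReal hp0.le] at this
    refine this.congr (Eventually.of_forall fun z => ?_)
    simp only [Real.norm_of_nonneg (h0 z)]
  have hnorm : ∫ z, h z ^ p ∂π ≤ C ^ p := by
    rw [hm.eLpNorm_eq_integral_rpow_norm hpe ENNReal.ofReal_ne_top,
      ENNReal.toReal_ofReal hp0.le, ENNReal.ofReal_le_ofReal_iff hC] at hn
    simp only [Real.norm_of_nonneg (h0 _)] at hn
    rwa [Real.rpow_inv_le_iff_of_pos (integral_nonneg fun z => Real.rpow_nonneg (h0 z) _) hC hp0]
      at hn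
  -- the entries are integrals against the weights `f_i ⊗ f_j`
  have hM : ∀ i j, quotientMatrix μ f i j = ∫ z, f i z.1 * f j z.2 * h z ∂π := fun i j => by
    simp only [quotientMatrix, Matrix.of_apply]
    rw [hμ, integral_withDensity_eq_integral_toReal_smul₀
      (hm.aestronglyMeasurable.aemeasurable.ennreal_ofReal)
      (Eventually.of_forall fun z => ENNReal.ofReal_lt_top)]
    refine integral_congr_ae (Eventually.of_forall fun z => ?_)
    simp only [ENNReal.toReal_ofReal (h0 z), smul_eq_mul]
    ring
  have hw0 : ∀ i j (z : Cantor × Cantor), 0 ≤ f i z.1 * f j z.2 := fun i j z =>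
    hf.1.entry_nonneg i j z
  have hwint : ∀ i j, ∫ z, f i z.1 * f j z.2 ∂π = α i * α j := fun i j => by
    rw [hπ, integral_prod_mul (f i) (f j), hf.2, hf.2]
  have hwp : ∀ i j, Integrable (fun z => f i z.1 * f j z.2 * h z ^ p) π := fun i j =>
    hpint.bdd_mul (c := 1) (hf.1.measurable_mul i j).aestronglyMeasurable
      (Eventually.of_forall fun z => by
        rw [Real.norm_of_nonneg (hw0 i j z)]; exact hf.1.entry_le_one i j z)
  -- Hölder's inequality for the finite measure with density `f_i ⊗ f_j`
  have hholder : ∀ i j, quotientMatrix μ f i j ≤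
      (∫ z, f i z.1 * f j z.2 * h z ^ p ∂π) ^ (1 / p) * (α i * α j) ^ (1 / q) := fun i j => by
    have hbd : ∀ r : ℝ, 0 < r → ∀ᵐ z ∂π, ‖(f i z.1 * f j z.2) ^ (1 / r)‖ ≤ 1 := fun r hr =>
      Eventually.of_forall fun z => by
        rw [Real.norm_of_nonneg (Real.rpow_nonneg (hw0 i j z) _)]
        exact Real.rpow_le_one (hw0 i j z) (hf.1.entry_le_one i j z) (by positivity)
    have hms : ∀ r : ℝ, AEStronglyMeasurable
        (fun z : Cantor × Cantor => (f i z.1 * f j z.2) ^ (1 / r)) π := fun r =>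
      ((hf.1.measurable_mul i j).pow_const _).aestronglyMeasurable
    have key := integral_mul_le_Lp_mul_Lq_of_nonneg (μ := π) hpq
      (f := fun z => (f i z.1 * f j z.2) ^ (1 / p) * h z)
      (g := fun z => (f i z.1 * f j z.2) ^ (1 / q))
      (Eventually.of_forall fun z => mul_nonneg (Real.rpow_nonneg (hw0 i j z) _) (h0 z))
      (Eventually.of_forall fun z => Real.rpow_nonneg (hw0 i j z) _)
      (MemLp.of_le hm ((hms p).mul hm.aestronglyMeasurable) (by
        filter_upwards [hbd p hp0] with z hz
        rw [norm_mul]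
        exact mul_le_of_le_one_left (norm_nonneg _) hz))
      (MemLp.of_bound (hms q) 1 (hbd q hq0))
    have e1 : ∀ z : Cantor × Cantor, (f i z.1 * f j z.2) ^ (1 / p) * h z *
        (f i z.1 * f j z.2) ^ (1 / q) = f i z.1 * f j z.2 * h z := fun z => by
      rw [mul_right_comm, ← Real.rpow_add_of_nonneg (hw0 i j z) (by positivity) (by positivity),
        one_div, one_div, hpq.inv_add_inv_eq_one, Real.rpow_one]
    have e2 : ∀ z : Cantor × Cantor, ((f i z.1 * f j z.2) ^ (1 / p) * h z) ^ p =
        f i z.1 * f j z.2 * h z ^ p := fun z => by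
      rw [Real.mul_rpow (Real.rpow_nonneg (hw0 i j z) _) (h0 z), ← Real.rpow_mul (hw0 i j z),
        one_div_mul_cancel hp0.ne', Real.rpow_one]
    have e3 : ∀ z : Cantor × Cantor, ((f i z.1 * f j z.2) ^ (1 / q)) ^ q =
        f i z.1 * f j z.2 := fun z => by
      rw [← Real.rpow_mul (hw0 i j z), one_div_mul_cancel hq0.ne', Real.rpow_one]
    simp only [e1, e2, e3] at key
    rwa [hwint, ← hM] at key
  have hterm : ∀ i j, |quotientMatrix μ f i j / (α i * α j)| ^ p * (α i * α j) ≤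
      ∫ z, f i z.1 * f j z.2 * h z ^ p ∂π := fun i j => by
    have ha : 0 < α i * α j := mul_pos (hα i) (hα j)
    set a := α i * α j
    have hI : 0 ≤ ∫ z, f i z.1 * f j z.2 * h z ^ p ∂π :=
      integral_nonneg fun z => mul_nonneg (hw0 i j z) (Real.rpow_nonneg (h0 z) _)
    have hM0 : 0 ≤ quotientMatrix μ f i j := hf.1.quotientMatrixOn_nonneg μ i j
    rw [abs_of_nonneg (div_nonneg hM0 ha.le), Real.div_rpow hM0 ha.le]
    have h1 := Real.rpow_le_rpow hM0 (hholder i j) hp0.le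
    rw [Real.mul_rpow (Real.rpow_nonneg hI _) (Real.rpow_nonneg ha.le _), ← Real.rpow_mul hI,
      one_div_mul_cancel hp0.ne', Real.rpow_one, ← Real.rpow_mul ha.le] at h1
    have h2 : a ^ (1 / q * p) * a = a ^ p := by
      nth_rewrite 2 [← Real.rpow_one a]
      rw [← Real.rpow_add ha]
      congr 1
      have := hpq.inv_add_inv_eq_one
      field_simp at this ⊢
      linarith
    have h3 : 0 < a ^ p := Real.rpow_pos_of_pos ha _
    rw [div_mul_eq_mul_div, div_le_iff₀ h3, ← h2]
    exact (mul_le_mul_of_nonneg_right h1 ha.le).trans (mul_assoc _ _ _).le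
  have hsum : ∑ i, ∑ j, |quotientMatrix μ f i j / (α i * α j)| ^ p * (α i * α j) ≤ C ^ p := by
    refine (Finset.sum_le_sum fun i _ => Finset.sum_le_sum fun j _ => hterm i j).trans ?_
    simp only [← integral_finsetSum _ fun j _ => hwp _ j]
    rw [← integral_finsetSum _ fun i _ => integrable_finsetSum _ fun j _ => hwp i j]
    refine le_of_eq_of_le (integral_congr_ae (Eventually.of_forall fun z => ?_)) hnorm
    simp only [← Finset.sum_mul, ← Finset.mul_sum, hf.1.sum_eq, mul_one, one_mul]
  calc weightedNorm α p (quotientMatrix μ f) ≤ (C ^ p) ^ (1 / p) := Real.rpow_le_rpow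
        (Finset.sum_nonneg fun i _ => Finset.sum_nonneg fun j _ => mul_nonneg
          (Real.rpow_nonneg (abs_nonneg _) _) (mul_pos (hα i) (hα j)).le) hsum (by positivity)
    _ = C := by rw [← Real.rpow_mul hC, mul_one_div_cancel hp0.ne', Real.rpow_one]

/-! ### Measures upper regular at all scales have a density in `Lᵖ` -/

/-- Upper regularity for all vectors of positive integrals, without a lower bound on them. -/
def IsUpperRegular (C p : ℝ) (μ : Measure (Cantor × Cantor)) : Prop :=
  ∀ (k : ℕ) (α : Fin k → ℝ), (∀ i, 0 < α i) → ∀ f ∈ fracPartitions α,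
    weightedNorm α p (quotientMatrix μ f) ≤ C

lemma isUpperRegular_of_forall {c C p : ℝ} {μ : SymMeasure c}
    (h : ∀ η > 0, μ ∈ shapeRegular c (C + η) p η) : IsUpperRegular C p μ.1 := by
  intro k α hα f hf
  have hf' := mem_fracPartitions_iff.1 hf
  have hα1 : ∑ i, α i = 1 := by
    simp only [← hf'.2]; exact hf'.1.sum_integral cantorMeasure
  have hk : 0 < k := by
    rcases Nat.eq_zero_or_pos k with rfl | h
    · simp at hα1
    · exact h
  have hle : ∀ i, α i ≤ 1 := fun i => by
    rw [← hα1]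
    exact Finset.single_le_sum (f := α) (fun j _ => (hα j).le) (Finset.mem_univ i)
  have : Nonempty (Fin k) := ⟨⟨0, hk⟩⟩
  obtain ⟨i₀, hi₀⟩ := Finite.exists_min α
  refine le_of_forall_pos_le_add fun ε hε => ?_
  refine (h (min ε (α i₀)) (lt_min hε (hα i₀)) k hk α
    (fun i => ⟨(min_le_right _ _).trans (hi₀ i), hle i⟩) hα1 f hf).trans ?_
  linarith [min_le_left ε (α i₀)]

/-- The duality bound `∫ g dμ ≤ C ‖g‖_q` for functions `g` that are constant on the products of
the members of a finite partition of the Cantor space. -/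
lemma IsUpperRegular.integral_le_of_factor {C p q : ℝ} {μ : Measure (Cantor × Cantor)}
    [IsFiniteMeasure μ] (h : IsUpperRegular C p μ) (hpq : p.HolderConjugate q) {k : ℕ}
    {s : Cantor → Fin k} (hs : Measurable s) (hpos : ∀ i, 0 < cantorMeasure.real (s ⁻¹' {i}))
    (φ : Fin k × Fin k → ℝ) :
    ∫ z, φ (s z.1, s z.2) ∂μ ≤
      C * (∫ z, |φ (s z.1, s z.2)| ^ q ∂(cantorMeasure.prod cantorMeasure)) ^ (1 / q) := by
  set α : Fin k → ℝ := fun i => cantorMeasure.real (s ⁻¹' {i}) with hα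
  have hsi : ∀ i, MeasurableSet (s ⁻¹' {i}) := fun i => hs (measurableSet_singleton i)
  set f : Fin k → Cantor → ℝ := fun i => (s ⁻¹' {i}).indicator 1 with hf
  have hfs : ∀ i x, f i x = if s x = i then 1 else 0 := fun i x => by
    simp only [hf, Set.indicator, mem_preimage, mem_singleton_iff, Pi.one_apply]
  have hfm : f ∈ fracPartitions α := by
    refine ⟨fun i => measurable_one.indicator (hsi i), fun i x => ?_, fun x => ?_, fun i => ?_⟩
    · rw [hfs]; split_ifs <;> norm_num
    · simp [hfs]
    · exact integral_indicator_one (hsi i)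
  have hS : Measurable fun z : Cantor × Cantor => (s z.1, s z.2) :=
    (hs.comp measurable_fst).prodMk (hs.comp measurable_snd)
  have hsum : ∀ (σ : Measure (Cantor × Cantor)) [IsFiniteMeasure σ] (ψ : Fin k × Fin k → ℝ),
      ∫ z, ψ (s z.1, s z.2) ∂σ =
        ∑ t, σ.real ((fun z : Cantor × Cantor => (s z.1, s z.2)) ⁻¹' {t}) * ψ t := fun σ _ ψ => by
    rw [← integral_map (φ := fun z : Cantor × Cantor => (s z.1, s z.2)) (f := ψ) hS.aemeasurable
      (measurable_of_finite ψ).aestronglyMeasurable, integral_fintype Integrable.of_finite]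
    refine Finset.sum_congr rfl fun t _ => ?_
    rw [map_measureReal_apply hS (measurableSet_singleton t), smul_eq_mul]
  have hM : ∀ t : Fin k × Fin k, quotientMatrix μ f t.1 t.2 =
      μ.real ((fun z : Cantor × Cantor => (s z.1, s z.2)) ⁻¹' {t}) := fun t => by
    simp only [quotientMatrix, Matrix.of_apply]
    rw [← integral_indicator_one (hS (measurableSet_singleton t))]
    refine integral_congr_ae (Eventually.of_forall fun z => ?_)
    simp only [hfs, Set.indicator, mem_preimage, mem_singleton_iff, Prod.ext_iff, Pi.one_apply]
    split_ifs <;> simp_all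
  have hπ : ∀ t : Fin k × Fin k, (cantorMeasure.prod cantorMeasure).real
      ((fun z : Cantor × Cantor => (s z.1, s z.2)) ⁻¹' {t}) = α t.1 * α t.2 := fun t => by
    have : (fun z : Cantor × Cantor => (s z.1, s z.2)) ⁻¹' {t} =
        (s ⁻¹' {t.1}) ×ˢ (s ⁻¹' {t.2}) := by
      ext z; simp [Prod.ext_iff]
    rw [this, measureReal_prod_prod]
  have key := Real.inner_le_Lp_mul_Lq Finset.univ
    (fun t : Fin k × Fin k =>
      quotientMatrix μ f t.1 t.2 / (α t.1 * α t.2) * (α t.1 * α t.2) ^ (1 / p))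
    (fun t => φ t * (α t.1 * α t.2) ^ (1 / q)) hpq
  rw [← weightedNorm_eq hpos hpq.lt.le] at key
  have hq0 : 0 < q := hpq.symm.pos
  have e1 : ∀ t : Fin k × Fin k, quotientMatrix μ f t.1 t.2 / (α t.1 * α t.2) *
      (α t.1 * α t.2) ^ (1 / p) * (φ t * (α t.1 * α t.2) ^ (1 / q)) =
      quotientMatrix μ f t.1 t.2 * φ t := fun t => by
    have ha : 0 < α t.1 * α t.2 := mul_pos (hpos _) (hpos _)
    have h2 : (α t.1 * α t.2) ^ (1 / p) * (α t.1 * α t.2) ^ (1 / q) = α t.1 * α t.2 := by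
      rw [← Real.rpow_add ha, one_div, one_div, hpq.inv_add_inv_eq_one, Real.rpow_one]
    calc _ = quotientMatrix μ f t.1 t.2 / (α t.1 * α t.2) *
          ((α t.1 * α t.2) ^ (1 / p) * (α t.1 * α t.2) ^ (1 / q)) * φ t := by ring
      _ = _ := by rw [h2, div_mul_cancel₀ _ ha.ne']
  have e2 : ∀ t : Fin k × Fin k, |φ t * (α t.1 * α t.2) ^ (1 / q)| ^ q =
      α t.1 * α t.2 * |φ t| ^ q := fun t => by
    have ha : 0 < α t.1 * α t.2 := mul_pos (hpos _) (hpos _)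
    rw [abs_mul, abs_of_nonneg (Real.rpow_nonneg ha.le _), Real.mul_rpow (abs_nonneg _)
      (Real.rpow_nonneg ha.le _), ← Real.rpow_mul ha.le, one_div_mul_cancel hq0.ne',
      Real.rpow_one, mul_comm]
  simp only [e1, e2] at key
  rw [hsum μ φ, hsum _ fun t => |φ t| ^ q]
  simp only [hπ, ← hM]
  refine key.trans (mul_le_mul_of_nonneg_right (h k α hpos f hfm) (Real.rpow_nonneg ?_ _))
  exact Finset.sum_nonneg fun t _ => mul_nonneg (mul_pos (hpos _) (hpos _)).le
    (Real.rpow_nonneg (abs_nonneg _) _)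

/-- The pair of initial segments of length `n` of two binary sequences. -/
def initialPair (n : ℕ) (z : Cantor × Cantor) : (Fin n → Bool) × (Fin n → Bool) :=
  (fun i => z.1 i, fun i => z.2 i)

lemma measurable_initialPair (n : ℕ) : Measurable (initialPair n) := by
  unfold initialPair
  fun_prop

/-- The filtration of `Cantor × Cantor` by the initial segments of both sequences. -/
def initialFiltration :
    Filtration ℕ (inferInstance : MeasurableSpace (Cantor × Cantor)) where
  seq n := MeasurableSpace.comap (initialPair n) inferInstance
  mono' := fun m n hmn => by
    have hr : Measurable fun w : (Fin n → Bool) × (Fin n → Bool) =>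
        ((fun i : Fin m => w.1 (Fin.castLE hmn i), fun i : Fin m => w.2 (Fin.castLE hmn i)) :
          (Fin m → Bool) × (Fin m → Bool)) := measurable_of_finite _
    have : initialPair m = (fun w : (Fin n → Bool) × (Fin n → Bool) =>
        ((fun i : Fin m => w.1 (Fin.castLE hmn i), fun i : Fin m => w.2 (Fin.castLE hmn i)) :
          (Fin m → Bool) × (Fin m → Bool))) ∘ initialPair n := rfl
    simp only [this, ← MeasurableSpace.comap_comp]
    exact MeasurableSpace.comap_mono hr.comap_le
  le' n := (measurable_initialPair n).comap_le

lemma iSup_initialFiltration :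
    ⨆ n, initialFiltration n = (inferInstance : MeasurableSpace (Cantor × Cantor)) := by
  refine le_antisymm (iSup_le fun n => initialFiltration.le n) ?_
  have hn : ∀ n, Measurable[⨆ n, initialFiltration n] (initialPair n) := fun n =>
    (comap_measurable (initialPair n)).mono (le_iSup (fun n => initialFiltration n) n) le_rfl
  have h1 : Measurable[⨆ n, initialFiltration n] (fun z : Cantor × Cantor => z.1) := by
    refine @measurable_pi_lambda _ _ _ (⨆ n, initialFiltration n) _ _ fun i => ?_
    exact ((measurable_pi_apply (Fin.last i)).comp measurable_fst).comp (hn (i + 1))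
  have h2 : Measurable[⨆ n, initialFiltration n] (fun z : Cantor × Cantor => z.2) := by
    refine @measurable_pi_lambda _ _ _ (⨆ n, initialFiltration n) _ _ fun i => ?_
    exact ((measurable_pi_apply (Fin.last i)).comp measurable_snd).comp (hn (i + 1))
  have h3 : Measurable[⨆ n, initialFiltration n] (id : Cantor × Cantor → Cantor × Cantor) :=
    h1.prodMk h2
  simpa using h3.comap_le

/-- The duality bound for functions measurable with respect to an initial segment. -/
lemma IsUpperRegular.integral_le_of_initialPair {C p q : ℝ} {μ : Measure (Cantor × Cantor)}
    [IsFiniteMeasure μ] (h : IsUpperRegular C p μ) (hpq : p.HolderConjugate q) (n : ℕ)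
    (φ : (Fin n → Bool) × (Fin n → Bool) → ℝ) :
    ∫ z, φ (initialPair n z) ∂μ ≤
      C * (∫ z, |φ (initialPair n z)| ^ q ∂(cantorMeasure.prod cantorMeasure)) ^ (1 / q) := by
  set e := Fintype.equivFin (Fin n → Bool)
  have hs : Measurable fun x : Cantor => e fun i : Fin n => x i :=
    (measurable_of_finite e).comp (measurable_pi_lambda _ fun i => measurable_pi_apply (i : ℕ))
  have hpos : ∀ j, 0 < cantorMeasure.real ((fun x : Cantor => e fun i : Fin n => x i) ⁻¹' {j}) :=
    fun j => by
    set w : Cantor := fun m => if hm : m < n then e.symm j ⟨m, hm⟩ else false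
    have hsub : {z : Cantor | ∀ m ∈ Finset.range n, z m = w m} ⊆
        (fun x : Cantor => e fun i : Fin n => x i) ⁻¹' {j} := fun z hz => by
      have : (fun i : Fin n => z i) = e.symm j := by
        funext i
        rw [hz i (Finset.mem_range.2 i.2)]
        simp [w]
      simp [this]
    refine ENNReal.toReal_pos (fun h0 => ?_) (measure_ne_top _ _)
    have h1 := measure_mono_null hsub h0
    rw [cantorMeasure_cylinder] at h1
    simp at h1
  have key := h.integral_le_of_factor hpq hs hpos fun t => φ (e.symm t.1, e.symm t.2)
  simp only [Equiv.symm_apply_apply] at key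
  exact key

/-- The duality bound `∫ g dμ ≤ C ‖g‖_q` for bounded functions: pass to the limit in the
conditional expectations on initial segments, taken with respect to `μ + ν × ν` so that the
convergence holds almost everywhere for both measures. -/
lemma IsUpperRegular.integral_le {C p q : ℝ} {μ : Measure (Cantor × Cantor)}
    [IsFiniteMeasure μ] (h : IsUpperRegular C p μ) (hpq : p.HolderConjugate q)
    {g : Cantor × Cantor → ℝ} (hg : Measurable g) {B : ℝ} (hB : ∀ z, |g z| ≤ B) :
    ∫ z, g z ∂μ ≤
      C * (∫ z, |g z| ^ q ∂(cantorMeasure.prod cantorMeasure)) ^ (1 / q) := by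
  set π := cantorMeasure.prod cantorMeasure
  have hq0 : 0 < q := hpq.symm.pos
  set lam := μ + π with hlam
  have hμl : μ ≪ lam := Measure.absolutelyContinuous_of_le (Measure.le_add_right le_rfl)
  have hπl : π ≪ lam := Measure.absolutelyContinuous_of_le (Measure.le_add_left le_rfl)
  have hgi : Integrable g lam := Integrable.of_bound hg.aestronglyMeasurable B
    (Eventually.of_forall hB)
  have hlim : ∀ᵐ z ∂lam, Tendsto (fun n => (lam[g | initialFiltration n]) z) atTop (𝓝 (g z)) := by
    have := tendsto_ae_condExp (μ := lam) (ℱ := initialFiltration) g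
    rw [iSup_initialFiltration, condExp_of_stronglyMeasurable le_rfl hg.stronglyMeasurable hgi]
      at this
    exact this
  have hbd : ∀ n, ∀ᵐ z ∂lam, |(lam[g | initialFiltration n]) z| ≤ B := fun n =>
    ae_bdd_abs_condExp_of_ae_bdd_abs (Eventually.of_forall hB)
  have hms : ∀ n, Measurable (lam[g | initialFiltration n]) := fun n =>
    (stronglyMeasurable_condExp.mono (initialFiltration.le n)).measurable
  have hn : ∀ n, ∫ z, (lam[g | initialFiltration n]) z ∂μ ≤
      C * (∫ z, |(lam[g | initialFiltration n]) z| ^ q ∂π) ^ (1 / q) := fun n => by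
    obtain ⟨φ, -, hφ⟩ := Measurable.exists_eq_measurable_comp (f := initialPair n)
      (g := lam[g | initialFiltration n]) stronglyMeasurable_condExp.measurable
    rw [hφ]
    exact h.integral_le_of_initialPair hpq n φ
  have l1 : Tendsto (fun n => ∫ z, (lam[g | initialFiltration n]) z ∂μ) atTop
      (𝓝 (∫ z, g z ∂μ)) :=
    tendsto_integral_of_dominated_convergence (fun _ => B)
      (fun n => (hms n).aestronglyMeasurable) (integrable_const _)
      (fun n => hμl.ae_le (hbd n)) (hμl.ae_le hlim)
  have l2 : Tendsto (fun n => ∫ z, |(lam[g | initialFiltration n]) z| ^ q ∂π) atTop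
      (𝓝 (∫ z, |g z| ^ q ∂π)) := by
    refine tendsto_integral_of_dominated_convergence (fun _ => B ^ q)
      (fun n => ((hms n).abs.pow_const q).aestronglyMeasurable) (integrable_const _)
      (fun n => ?_) ?_
    · filter_upwards [hπl.ae_le (hbd n)] with z hz
      rw [Real.norm_of_nonneg (Real.rpow_nonneg (abs_nonneg _) _)]
      exact Real.rpow_le_rpow (abs_nonneg _) hz hq0.le
    · filter_upwards [hπl.ae_le hlim] with z hz
      exact hz.abs.rpow_const (Or.inr hq0.le)
  exact le_of_tendsto_of_tendsto' l1
    ((l2.rpow_const (Or.inr (by positivity))).const_mul C) hn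

lemma IsUpperRegular.absolutelyContinuous {C p : ℝ} (hp : 1 < p)
    {μ : Measure (Cantor × Cantor)} [IsFiniteMeasure μ] (h : IsUpperRegular C p μ) :
    μ ≪ cantorMeasure.prod cantorMeasure := by
  refine Measure.AbsolutelyContinuous.mk fun s hs h0 => ?_
  have hpq := Real.HolderConjugate.conjExponent hp
  have hq0 := hpq.symm.pos
  have key := h.integral_le hpq (g := s.indicator 1) (measurable_one.indicator hs) (B := 1)
    fun z => by by_cases hz : z ∈ s <;> simp [hz]
  have h1 : ∫ z, |s.indicator (1 : Cantor × Cantor → ℝ) z| ^ p.conjExponent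
      ∂(cantorMeasure.prod cantorMeasure) = 0 := by
    refine integral_eq_zero_of_ae ?_
    filter_upwards [measure_eq_zero_iff_ae_notMem.1 h0] with z hz
    simp [hz, Real.zero_rpow hq0.ne']
  rw [h1, integral_indicator_one hs, Real.zero_rpow (one_div_pos.2 hq0).ne', mul_zero] at key
  exact (measureReal_eq_zero_iff (measure_ne_top _ _)).1 (le_antisymm key measureReal_nonneg)

/-- The duality bound applied to `g = min(h, K) ^ (p - 1)` bounds the truncations of the density
`h` in `Lᵖ`. -/
lemma IsUpperRegular.integral_min_rpow_le {C p : ℝ} (hp : 1 < p) (hC : 0 ≤ C)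
    {μ : Measure (Cantor × Cantor)} [IsFiniteMeasure μ] (h : IsUpperRegular C p μ) (K : ℕ) :
    ∫ z, (min (μ.rnDeriv (cantorMeasure.prod cantorMeasure) z).toReal K) ^ p
      ∂(cantorMeasure.prod cantorMeasure) ≤ C ^ p := by
  have hac := h.absolutelyContinuous hp
  set π := cantorMeasure.prod cantorMeasure
  have hpq := Real.HolderConjugate.conjExponent hp
  set q := p.conjExponent
  have hp0 := hpq.pos
  have hq0 := hpq.symm.pos
  set u : Cantor × Cantor → ℝ := fun z => (μ.rnDeriv π z).toReal with hu
  have hum : Measurable u := (Measure.measurable_rnDeriv μ π).ennreal_toReal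
  have hu0 : ∀ z, 0 ≤ u z := fun z => ENNReal.toReal_nonneg
  set v : Cantor × Cantor → ℝ := fun z => min (u z) K with hv
  have hvm : Measurable v := hum.min measurable_const
  have hv0 : ∀ z, 0 ≤ v z := fun z => le_min (hu0 z) K.cast_nonneg
  have hvK : ∀ z, v z ≤ K := fun z => min_le_right _ _
  have hp1 : 0 < p - 1 := sub_pos.2 hp
  have hgm : Measurable fun z => v z ^ (p - 1) := hvm.pow_const _
  have hgB : ∀ z, |v z ^ (p - 1)| ≤ (K : ℝ) ^ (p - 1) := fun z => by
    rw [abs_of_nonneg (Real.rpow_nonneg (hv0 z) _)]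
    exact Real.rpow_le_rpow (hv0 z) (hvK z) hp1.le
  have key := h.integral_le hpq hgm hgB
  have e1 : ∀ z, |v z ^ (p - 1)| ^ q = v z ^ p := fun z => by
    rw [abs_of_nonneg (Real.rpow_nonneg (hv0 z) _), ← Real.rpow_mul (hv0 z), hpq.sub_one_mul_conj]
  simp only [e1] at key
  have hI0 : 0 ≤ ∫ z, v z ^ p ∂π := integral_nonneg fun z => Real.rpow_nonneg (hv0 z) _
  have hle : ∫ z, v z ^ p ∂π ≤ ∫ z, v z ^ (p - 1) ∂μ := by
    rw [← integral_rnDeriv_smul hac]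
    refine integral_mono ?_ ?_ fun z => ?_
    · refine Integrable.of_bound (hvm.pow_const p).aestronglyMeasurable ((K : ℝ) ^ p)
        (Eventually.of_forall fun z => ?_)
      rw [Real.norm_of_nonneg (Real.rpow_nonneg (hv0 z) _)]
      exact Real.rpow_le_rpow (hv0 z) (hvK z) hp0.le
    · simp only [smul_eq_mul]
      exact (Measure.integrable_toReal_rnDeriv (μ := μ) (ν := π)).mul_bdd
        hgm.aestronglyMeasurable (Eventually.of_forall hgB)
    · change v z ^ p ≤ u z * v z ^ (p - 1)
      calc v z ^ p = v z * v z ^ (p - 1) := by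
            rw [← Real.rpow_one_add' (hv0 z) (by linarith)]
            congr 1; ring
        _ ≤ _ := mul_le_mul_of_nonneg_right (min_le_left _ _) (Real.rpow_nonneg (hv0 z) _)
  have h2 := hle.trans key
  set I := ∫ z, v z ^ p ∂π
  rcases hI0.eq_or_lt with h0 | hpos
  · rw [← h0]; exact Real.rpow_nonneg hC _
  · -- divide `I ≤ C I ^ (1 / q)` by `I ^ (1 / q)`
    have h3 : I ^ (1 / p) ≤ C := by
      have h4 : I = I ^ (1 / p) * I ^ (1 / q) := by
        rw [← Real.rpow_add hpos, one_div, one_div, hpq.inv_add_inv_eq_one, Real.rpow_one]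
      exact le_of_mul_le_mul_right (h4.symm.trans_le h2) (Real.rpow_pos_of_pos hpos _)
    calc I = (I ^ (1 / p)) ^ p := by
          rw [← Real.rpow_mul hI0, one_div_mul_cancel hp0.ne', Real.rpow_one]
      _ ≤ C ^ p := Real.rpow_le_rpow (Real.rpow_nonneg hI0 _) h3 hp0.le

lemma mem_lpBall_of_isUpperRegular {c C p : ℝ} (hp : 1 < p) (hC : 0 ≤ C) {μ : SymMeasure c}
    (h : IsUpperRegular C p μ.1) : μ ∈ lpBall c C p := by
  have hac := h.absolutelyContinuous hp
  set π := cantorMeasure.prod cantorMeasure with hπ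
  have hp0 : 0 < p := one_pos.trans hp
  set u : Cantor × Cantor → ℝ := fun z => (μ.1.rnDeriv π z).toReal with hu
  have hum : Measurable u := (Measure.measurable_rnDeriv μ.1 π).ennreal_toReal
  have hu0 : ∀ z, 0 ≤ u z := fun z => ENNReal.toReal_nonneg
  have hv0 : ∀ (K : ℕ) z, 0 ≤ min (u z) K := fun K z => le_min (hu0 z) K.cast_nonneg
  have hlint : ∫⁻ z, ENNReal.ofReal (u z ^ p) ∂π ≤ ENNReal.ofReal (C ^ p) := by
    have hlim := lintegral_tendsto_of_tendsto_of_monotone (μ := π)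
      (f := fun (K : ℕ) z => ENNReal.ofReal (min (u z) K ^ p))
      (F := fun z => ENNReal.ofReal (u z ^ p))
      (fun K => ((hum.min measurable_const).pow_const p).ennreal_ofReal.aemeasurable)
      (Eventually.of_forall fun z K L hKL => ENNReal.ofReal_le_ofReal
        (Real.rpow_le_rpow (hv0 K z) (min_le_min_left _ (by exact_mod_cast hKL)) hp0.le))
      (Eventually.of_forall fun z => by
        refine tendsto_const_nhds.congr' ?_
        obtain ⟨K, hK⟩ := exists_nat_ge (u z)
        filter_upwards [eventually_ge_atTop K] with L hL
        rw [min_eq_left (hK.trans (by exact_mod_cast hL))])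
    refine le_of_tendsto' hlim fun K => ?_
    rw [← ofReal_integral_eq_lintegral_ofReal]
    · exact ENNReal.ofReal_le_ofReal (h.integral_min_rpow_le hp hC K)
    · refine Integrable.of_bound ((hum.min measurable_const).pow_const p).aestronglyMeasurable
        ((K : ℝ) ^ p) (Eventually.of_forall fun z => ?_)
      rw [Real.norm_of_nonneg (Real.rpow_nonneg (hv0 K z) _)]
      exact Real.rpow_le_rpow (hv0 K z) (min_le_right _ _) hp0.le
    · exact Eventually.of_forall fun z => Real.rpow_nonneg (hv0 K z) _
  have hpe : ENNReal.ofReal p ≠ 0 := by simpa using hp0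
  have hnorm : eLpNorm u (ENNReal.ofReal p) π ≤ ENNReal.ofReal C := by
    rw [eLpNorm_eq_lintegral_rpow_enorm_toReal hpe ENNReal.ofReal_ne_top,
      ENNReal.toReal_ofReal hp0.le]
    have e : ∀ z, ‖u z‖ₑ ^ p = ENNReal.ofReal (u z ^ p) := fun z => by
      rw [Real.enorm_of_nonneg (hu0 z), ENNReal.ofReal_rpow_of_nonneg (hu0 z) hp0.le]
    simp only [e]
    calc _ ≤ ENNReal.ofReal (C ^ p) ^ (1 / p) := ENNReal.rpow_le_rpow hlint (by positivity)
      _ = ENNReal.ofReal C := by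
        rw [ENNReal.ofReal_rpow_of_nonneg (Real.rpow_nonneg hC _) (by positivity),
          ← Real.rpow_mul hC, mul_one_div_cancel hp0.ne', Real.rpow_one]
  refine ⟨u, hu0, ⟨hum.aestronglyMeasurable, hnorm.trans_lt ENNReal.ofReal_lt_top⟩, hnorm, ?_⟩
  rw [← hπ, ← Measure.withDensity_rnDeriv_eq μ.1 π hac]
  refine withDensity_congr_ae ?_
  filter_upwards [Measure.rnDeriv_lt_top μ.1 π] with z hz
  exact (ENNReal.ofReal_toReal hz.ne).symm

lemma lpBall_eq_iInter {c C p : ℝ} (hp : 1 < p) (hC : 0 ≤ C) :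
    lpBall c C p = ⋂ η' ∈ Ioi (0 : ℝ), shapeRegular c (C + η') p η' := by
  refine Subset.antisymm (fun μ hμ => ?_) fun μ hμ => ?_
  · obtain ⟨h, h0, hm, hn, he⟩ := hμ
    refine mem_iInter₂.2 fun η' hη' k _ α hα _ f hf => ?_
    have hη0 : 0 < η' := hη'
    exact (weightedNorm_withDensity_le (fun i => hη0.trans_le (hα i).1) hp hC hf h0 hm hn he).trans
      (le_add_of_nonneg_right hη0.le)
  · exact mem_lpBall_of_isUpperRegular hp hC
      (isUpperRegular_of_forall fun η' hη' => mem_iInter₂.1 hμ η' hη')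

end ShapeLimits

theorem mainTheorem12 (c C p η : ℝ) (hc : 0 < c) (hC : 0 ≤ C) (hp : 1 < p)
    (hη : 0 < η) (hη1 : η ≤ 1) :
    IsCompact (ShapeLimits.shapeRegular c C p η) ∧
    (⋃ ε ∈ Set.Ioo 0 C, ShapeLimits.shapeRegular c (C - ε) p η) ⊆
      interior (ShapeLimits.shapeRegular c C p η) ∧
    (∀ μ ∈ interior (ShapeLimits.shapeRegular c C p η),
      μ.1 Set.univ < ENNReal.ofReal c →
        μ ∈ ⋃ ε ∈ Set.Ioo 0 C, ShapeLimits.shapeRegular c (C - ε) p η) ∧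
    (C < c → interior (ShapeLimits.shapeRegular c C p η) =
      ⋃ ε ∈ Set.Ioo 0 C, ShapeLimits.shapeRegular c (C - ε) p η) ∧
    ShapeLimits.lpBall c C p =
      ⋂ η' ∈ Set.Ioi (0 : ℝ), ShapeLimits.shapeRegular c (C + η') p η' := by
  have hsub : (⋃ ε ∈ Ioo 0 C, ShapeLimits.shapeRegular c (C - ε) p η) ⊆
      interior (ShapeLimits.shapeRegular c C p η) :=
    iUnion₂_subset fun ε hε =>
      ShapeLimits.shapeRegular_subset_interior hc.le hp.le hη (sub_lt_self C hε.1)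
  refine ⟨ShapeLimits.isCompact_shapeRegular hc.le hp.le hη, hsub, fun μ hμ hμc => ?_,
    fun hCc => ?_, ShapeLimits.lpBall_eq_iInter hp hC⟩
  · refine ShapeLimits.mem_iUnion_of_mem_interior hc hC hp.le hη hη1 hμ ?_
    exact (ENNReal.lt_ofReal_iff_toReal_lt (measure_ne_top _ _)).1 hμc
  · refine Subset.antisymm (fun μ hμ => ?_) hsub
    exact ShapeLimits.mem_iUnion_of_mem_interior hc hC hp.le hη hη1 hμ
      ((ShapeLimits.real_univ_le_of_mem_shapeRegular hp.le hη1 (interior_subset hμ)).trans_lt hCc)
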